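/- Let $M=(M_p)_{p\in\mathbb Z_+}$ be a sequence of positive numbers with $M_0=1$ satisfying: (H1) $M_p^2\le M_{p-1}M_{p+1}$ for $p\ge 1$; (H2) there are $A,H>0$ with $M_p\le AH^pM_qM_{p-q}$ for all $p\ge q$; (H3)$'$ $\sum_{p\ge1}M_{p-1}/M_p<\infty$. Put $\widetilde M(t)=\sup_p\ln(t^p/M_p)$ for $t>0$. Let $\Omega\subset\mathbb R^n$ be open and let $\mathcal G(\Omega)=\mathcal X(\Omega)/\mathcal N(\Omega)$ be the Colombeau algebra, where $\mathcal X(\Omega)$ consists of the nets $(u_\varepsilon)_{\varepsilon\in]0,1]}$ in $C^\infty(\Omega)$ such that for all compact $K\subset\Omega$ and all $\alpha$ there is $m\in\mathbb Z_+$ with $\sup_K|\partial^\alpha u_\varepsilon|=O(\varepsilon^{-m})$ as $\varepsilon\to0$, and $\mathcal N(\Omega)$ of those with $\sup_K|\partial^\alpha u_\varepsilon|=O(\varepsilon^{m})$ for all $K$, $\alpha$ and $m\in\mathbb Z_+$. Let $\mathcal A$ be the set of sequences $(N_m)_{m\in\mathbb Z_+}$ of nonnegative reals for which there are $a,b\ge0$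 with $N_m\le am+b$ for all $m$. Let $\mathcal G^{M,\mathcal A}(\Omega)\subset\mathcal G(\Omega)$ be the set of classes having a representative $(u_\varepsilon)$ such that for every compact $K\subset\Omega$ there are $N\in\mathcal A$, $C>0$, $\varepsilon_0\in]0,1]$ with $\sup_K|\partial^\alpha u_\varepsilon|\le C^{|\alpha|+1}M_{|\alpha|}\varepsilon^{-N_{|\alpha|}}$ for all $\alpha\in\mathbb Z_+^n$ and all $\varepsilon\le\varepsilon_0$. For $f\in\mathcal G(\Omega)$, $\mathrm{singsupp}_{M,\mathcal A}(f)$ is the complement in $\Omega$ of the largest open set $\Omega'\subset\Omega$ (the union of all open sets $\Omega'\subset\Omega$) such that $f|_{\Omega'}\in\mathcal G^{M,\mathcal A}(\Omega')$. Let $\mathcal D^M(\Omega)$ be the space of $\phi\in C^\infty(\Omega)$ with compact support in $\Omega$ such that for every compact $K\subset\Omega$ there is $c>0$ with $\sup_K|\partial^\alpha\phi|\le c^{|\alpha|+1}M_{|\alpha|}$ for all $\alpha$. For $g\in\mathcal G(\Omega)$ with compact support, let $\Sigma^M_{\mathcal A}(g)$ be the complement in $\mathbb R^n\setminus\{0\}$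 of the set of $\xi_0$ for which there are an open cone $\Gamma\ni\xi_0$ in $\mathbb R^n\setminus\{0\}$, a representative $(g_\varepsilon)$ of $g$ with supports in a common compact subset of $\Omega$, and $a\ge0$, $b\ge0$, $C>0$, $k>0$, $\varepsilon_0\in]0,1]$ such that $$|\mathcal F(g_\varepsilon)(\xi)|\le C\varepsilon^{-b}\exp\bigl(-\widetilde M(k\varepsilon^a|\xi|)\bigr)\qquad\text{for all }\varepsilon\le\varepsilon_0,\ \xi\in\Gamma,$$ where $\mathcal F$ is the Fourier transform. For $f\in\mathcal G(\Omega)$ and $x_0\in\Omega$, the cone of affine singular directions of class $M$ of $f$ at $x_0$ is $$\Sigma^M_{\mathcal A,x_0}(f)=\bigcap\{\Sigma^M_{\mathcal A}(\phi f):\phi\in\mathcal D^M(\Omega),\ \phi=1\text{ on a neighborhood of }x_0\}.$$ Then, for every $f\in\mathcal G(\Omega)$ and every $x_0\in\Omega$, $$\Sigma^M_{\mathcal A,x_0}(f)=\emptyset\iff x_0\notin\mathrm{singsupp}_{M,\mathcal A}(f).$$ -/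

import Mathlib

open scoped ContDiff Topology NNReal

namespace Ultraregular

noncomputable section

/-- The space `ℝⁿ` with its Euclidean norm. -/
abbrev Space (n : ℕ) : Type := EuclideanSpace ℝ (Fin n)

/-- The set `]0,1]` of values of the parameter `ε`. -/
abbrev Eps : Type := Set.Ioc (0 : ℝ) 1

/-- Nets `(u_ε)` of complex functions. Whenever a net is considered on an open set `Ω`, only its
values on `Ω` matter. -/
abbrev Net (n : ℕ) : Type := Eps → Space n → ℂ

/-- The partial derivative `∂_{w 0} ⋯ ∂_{w (k-1)} f` at `x`. For smooth `f` the order of the letters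
of the word `w` is immaterial, so words of length `k` give exactly the derivatives `∂^α f`
with `|α| = k`. -/
def pderiv {n k : ℕ} (w : Fin k → Fin n) (f : Space n → ℂ) (x : Space n) : ℂ :=
  iteratedFDeriv ℝ k f x (fun j => EuclideanSpace.single (w j) (1 : ℝ))

/-- Moderate nets of smooth functions on `Ω`. -/
def IsModerate {n : ℕ} (Ω : TopologicalSpace.Opens (Space n)) (u : Net n) : Prop :=
  (∀ ε, ContDiffOn ℝ ∞ (u ε) Ω) ∧
    ∀ K : Set (Space n), IsCompact K → K ⊆ Ω → ∀ (k : ℕ) (w : Fin k → Fin n),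
      ∃ m : ℕ, ∃ C : ℝ, 0 < C ∧ ∃ η : Eps, ∀ ε : Eps, ε ≤ η → ∀ x ∈ K,
        ‖pderiv w (u ε) x‖ ≤ C * (ε : ℝ) ^ (-(m : ℤ))

/-- The estimates defining negligible nets on `Ω` (among the moderate ones). -/
def IsNegligible {n : ℕ} (Ω : TopologicalSpace.Opens (Space n)) (u : Net n) : Prop :=
  ∀ K : Set (Space n), IsCompact K → K ⊆ Ω → ∀ (k : ℕ) (w : Fin k → Fin n),
    ∀ m : ℕ, ∃ C : ℝ, 0 < C ∧ ∃ η : Eps, ∀ ε : Eps, ε ≤ η → ∀ x ∈ K,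
      ‖pderiv w (u ε) x‖ ≤ C * (ε : ℝ) ^ (m : ℤ)

/-! ### Auxiliary estimates: moderate nets form an algebra, negligible ones an ideal -/

/-- The bound `‖D^k u_ε‖ = O(ε^s)`, uniformly on `K`. -/
def Bd {n : ℕ} (K : Set (Space n)) (k : ℕ) (s : ℤ) (u : Net n) : Prop :=
  ∃ C : ℝ, 0 < C ∧ ∃ η : Eps, ∀ ε : Eps, ε ≤ η → ∀ x ∈ K,
    ‖iteratedFDeriv ℝ k (u ε) x‖ ≤ C * (ε : ℝ) ^ s

theorem norm_pderiv_le {n k : ℕ} (w : Fin k → Fin n) (f : Space n → ℂ) (x : Space n) :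
    ‖pderiv w f x‖ ≤ ‖iteratedFDeriv ℝ k f x‖ := by
  have h := (iteratedFDeriv ℝ k f x).le_opNorm
    (fun j => EuclideanSpace.single (w j) (1 : ℝ))
  simpa [pderiv] using h

theorem norm_iteratedFDeriv_le_of_pderiv {n k : ℕ} (f : Space n → ℂ) (x : Space n) {B : ℝ}
    (hB : 0 ≤ B) (h : ∀ w : Fin k → Fin n, ‖pderiv w f x‖ ≤ B) :
    ‖iteratedFDeriv ℝ k f x‖ ≤ (Fintype.card (Fin k → Fin n)) * B := by
  refine ContinuousMultilinearMap.opNorm_le_bound (by positivity) (fun v => ?_)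
  have hv : v = fun j => ∑ i, (v j i) • (EuclideanSpace.single i (1 : ℝ) : Space n) := by
    funext j
    ext l
    simp [Pi.single_apply]
  have hexp : iteratedFDeriv ℝ k f x v
      = ∑ w : Fin k → Fin n, (∏ j, v j (w j)) • pderiv w f x := by
    conv_lhs => rw [hv]
    rw [ContinuousMultilinearMap.map_sum]
    refine Finset.sum_congr rfl (fun w _ => ?_)
    rw [ContinuousMultilinearMap.map_smul_univ]
    rfl
  rw [hexp]
  refine (norm_sum_le _ _).trans ?_
  have hle : ∀ w ∈ (Finset.univ : Finset (Fin k → Fin n)),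
      ‖(∏ j, v j (w j)) • pderiv w f x‖ ≤ B * ∏ j, ‖v j‖ := by
    intro w _
    rw [norm_smul, mul_comm, norm_prod]
    refine mul_le_mul (h w) ?_ (Finset.prod_nonneg fun _ _ => norm_nonneg _) hB
    exact Finset.prod_le_prod (fun _ _ => norm_nonneg _) (fun j _ => PiLp.norm_apply_le _ _)
  refine (Finset.sum_le_sum hle).trans ?_
  simp [mul_assoc]

theorem Bd.mono {n : ℕ} {K : Set (Space n)} {k : ℕ} {s t : ℤ} {u : Net n} (h : Bd K k s u)
    (hts : t ≤ s) : Bd K k t u := by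
  obtain ⟨C, hC, η, H⟩ := h
  refine ⟨C, hC, η, fun ε hε x hx => (H ε hε x hx).trans ?_⟩
  exact mul_le_mul_of_nonneg_left (zpow_le_zpow_right_of_le_one₀ ε.2.1 ε.2.2 hts) hC.le

/-- Constants for finitely many estimates can be chosen in common. -/
theorem exists_common {ι : Type} [Finite ι] {P : ι → ℝ → Eps → Prop}
    (hP : ∀ i C C' η η', C ≤ C' → η' ≤ η → P i C η → P i C' η')
    (h : ∀ i, ∃ C : ℝ, 0 < C ∧ ∃ η : Eps, P i C η) :
    ∃ C : ℝ, 0 < C ∧ ∃ η : Eps, ∀ i, P i C η := by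
  choose C _ η H using h
  obtain ⟨C', hC'⟩ := Finite.exists_le C
  have : Nonempty Eps := ⟨⟨1, one_pos, le_rfl⟩⟩
  obtain ⟨η', hη'⟩ := Finite.exists_ge η
  exact ⟨max C' 1, lt_max_of_lt_right one_pos, η', fun i =>
    hP i _ _ _ _ ((hC' i).trans (le_max_left _ _)) (hη' i) (H i)⟩

theorem bd_of_pderiv {n : ℕ} {K : Set (Space n)} {k : ℕ} {s : ℤ} {u : Net n}
    (h : ∀ w : Fin k → Fin n, ∃ C : ℝ, 0 < C ∧ ∃ η : Eps, ∀ ε : Eps, ε ≤ η → ∀ x ∈ K,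
      ‖pderiv w (u ε) x‖ ≤ C * (ε : ℝ) ^ s) : Bd K k s u := by
  obtain ⟨C, hC, η, H⟩ := exists_common
    (P := fun (w : Fin k → Fin n) (C : ℝ) (η : Eps) => ∀ ε : Eps, ε ≤ η → ∀ x ∈ K,
      ‖pderiv w (u ε) x‖ ≤ C * (ε : ℝ) ^ s)
    (fun w C C' η η' hC hη H ε hε x hx => (H ε (hε.trans hη) x hx).trans
      (mul_le_mul_of_nonneg_right hC (zpow_nonneg ε.2.1.le _))) h
  refine ⟨(Fintype.card (Fin k → Fin n) + 1) * C, by positivity, η, fun ε hε x hx => ?_⟩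
  have hpos : 0 ≤ C * (ε : ℝ) ^ s := mul_nonneg hC.le (zpow_nonneg ε.2.1.le _)
  have := norm_iteratedFDeriv_le_of_pderiv (u ε) x hpos (fun w => H w ε hε x hx)
  calc _ ≤ _ := this
    _ ≤ _ := by rw [mul_assoc]; gcongr; linarith

theorem Bd.pderiv {n : ℕ} {K : Set (Space n)} {k : ℕ} {s : ℤ} {u : Net n} (h : Bd K k s u)
    (w : Fin k → Fin n) : ∃ C : ℝ, 0 < C ∧ ∃ η : Eps, ∀ ε : Eps, ε ≤ η → ∀ x ∈ K,
      ‖pderiv w (u ε) x‖ ≤ C * (ε : ℝ) ^ s := by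
  obtain ⟨C, hC, η, H⟩ := h
  exact ⟨C, hC, η, fun ε hε x hx => (norm_pderiv_le _ _ _).trans (H ε hε x hx)⟩

theorem Bd.add {n : ℕ} {Ω : TopologicalSpace.Opens (Space n)} {K : Set (Space n)} {k : ℕ} {s : ℤ}
    {u v : Net n} (hu : ∀ ε, ContDiffOn ℝ ∞ (u ε) Ω) (hv : ∀ ε, ContDiffOn ℝ ∞ (v ε) Ω)
    (hK : K ⊆ Ω) (h : Bd K k s u) (h' : Bd K k s v) : Bd K k s (u + v) := by
  obtain ⟨C, hC, η, H⟩ := h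
  obtain ⟨C', hC', η', H'⟩ := h'
  refine ⟨C + C', by positivity, min η η', fun ε hε x hx => ?_⟩
  have hΩ : (Ω : Set (Space n)) ∈ 𝓝 x := Ω.isOpen.mem_nhds (hK hx)
  have e : iteratedFDeriv ℝ k ((u + v) ε) x
      = iteratedFDeriv ℝ k (u ε) x + iteratedFDeriv ℝ k (v ε) x := by
    rw [Pi.add_apply]
    exact iteratedFDeriv_add_apply
      (((hu ε).contDiffAt hΩ).of_le (by exact_mod_cast le_top))
      (((hv ε).contDiffAt hΩ).of_le (by exact_mod_cast le_top))
  rw [e, add_mul]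
  exact (norm_add_le _ _).trans (add_le_add (H ε (hε.trans (min_le_left _ _)) x hx)
    (H' ε (hε.trans (min_le_right _ _)) x hx))

theorem Bd.mul {n : ℕ} {Ω : TopologicalSpace.Opens (Space n)} {K : Set (Space n)} {k : ℕ} {s t : ℤ}
    {u v : Net n} (hu : ∀ ε, ContDiffOn ℝ ∞ (u ε) Ω) (hv : ∀ ε, ContDiffOn ℝ ∞ (v ε) Ω)
    (hK : K ⊆ Ω) (h : ∀ j ≤ k, Bd K j s u) (h' : ∀ j ≤ k, Bd K j t v) :
    Bd K k (s + t) (u * v) := by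
  have key : ∀ (s : ℤ) (u : Net n), (∀ j ≤ k, Bd K j s u) → ∃ C : ℝ, 0 < C ∧ ∃ η : Eps,
      ∀ i : Fin (k + 1), ∀ ε : Eps, ε ≤ η → ∀ x ∈ K,
        ‖iteratedFDeriv ℝ i (u ε) x‖ ≤ C * (ε : ℝ) ^ s := fun s u h => exists_common
    (P := fun (i : Fin (k + 1)) (C : ℝ) (η : Eps) => ∀ ε : Eps, ε ≤ η → ∀ x ∈ K,
      ‖iteratedFDeriv ℝ i (u ε) x‖ ≤ C * (ε : ℝ) ^ s)
    (fun w C C' η η' hC hη H ε hε x hx => (H ε (hε.trans hη) x hx).trans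
      (mul_le_mul_of_nonneg_right hC (zpow_nonneg ε.2.1.le _)))
    (fun i => h i (Nat.lt_succ_iff.1 i.2))
  obtain ⟨C, hC, η, H⟩ := key s u h
  obtain ⟨C', hC', η', H'⟩ := key t v h'
  refine ⟨2 ^ k * (C * C'), by positivity, min η η', fun ε hε x hx => ?_⟩
  have hx' : x ∈ (Ω : Set (Space n)) := hK hx
  have hW := norm_iteratedFDerivWithin_mul_le (𝕜 := ℝ) (hu ε) (hv ε) Ω.isOpen.uniqueDiffOn hx'
    (n := k) (by exact_mod_cast le_top)
  simp only [iteratedFDerivWithin_of_isOpen _ Ω.isOpen hx'] at hW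
  refine hW.trans ?_
  have hε0 : (ε : ℝ) ≠ 0 := ε.2.1.ne'
  have hsum : ∀ i ∈ Finset.range (k + 1), (k.choose i : ℝ) * ‖iteratedFDeriv ℝ i (u ε) x‖ *
      ‖iteratedFDeriv ℝ (k - i) (v ε) x‖ ≤ (k.choose i : ℝ) * ((C * C') * (ε : ℝ) ^ (s + t)) := by
    intro i hi
    have h1 := H ⟨i, Finset.mem_range.1 hi⟩ ε (hε.trans (min_le_left _ _)) x hx
    have h2 := H' ⟨k - i, by omega⟩ ε (hε.trans (min_le_right _ _)) x hx
    rw [zpow_add₀ hε0, mul_assoc]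
    refine mul_le_mul_of_nonneg_left ?_ (by positivity)
    refine (mul_le_mul h1 h2 (norm_nonneg _) (mul_nonneg hC.le (zpow_nonneg ε.2.1.le _))).trans
      (le_of_eq (by ring))
  refine (Finset.sum_le_sum hsum).trans (le_of_eq ?_)
  rw [← Finset.sum_mul]
  have : (∑ i ∈ Finset.range (k + 1), (k.choose i : ℝ)) = 2 ^ k := by
    exact_mod_cast Nat.sum_range_choose k
  rw [this]
  ring

theorem IsModerate.bd {n : ℕ} {Ω : TopologicalSpace.Opens (Space n)} {u : Net n}
    (h : IsModerate Ω u) {K : Set (Space n)} (hK : IsCompact K) (hKΩ : K ⊆ Ω) (k : ℕ) :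
    ∃ m : ℕ, ∀ j ≤ k, Bd K j (-(m : ℤ)) u := by
  have h1 : ∀ j : ℕ, ∃ m : ℕ, Bd K j (-(m : ℤ)) u := by
    intro j
    choose m hm using h.2 K hK hKΩ j
    obtain ⟨m', hm'⟩ := Finite.exists_le m
    refine ⟨m', bd_of_pderiv fun w => ?_⟩
    obtain ⟨C, hC, η, H⟩ := hm w
    refine ⟨C, hC, η, fun ε hε x hx => (H ε hε x hx).trans ?_⟩
    have := hm' w
    exact mul_le_mul_of_nonneg_left
      (zpow_le_zpow_right_of_le_one₀ ε.2.1 ε.2.2 (by omega)) hC.le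
  choose m hm using h1
  obtain ⟨m', hm'⟩ := Finite.exists_le (fun i : Fin (k + 1) => m i)
  refine ⟨m', fun j hj => (hm j).mono ?_⟩
  have : m j ≤ m' := hm' ⟨j, Nat.lt_succ_iff.2 hj⟩
  omega

theorem IsNegligible.bd {n : ℕ} {Ω : TopologicalSpace.Opens (Space n)} {u : Net n}
    (h : IsNegligible Ω u) {K : Set (Space n)} (hK : IsCompact K) (hKΩ : K ⊆ Ω) (k m : ℕ) :
    Bd K k m u :=
  bd_of_pderiv fun w => h K hK hKΩ k w m

/-- A net that does not depend on `ε` is moderate. -/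
theorem isModerate_const {n : ℕ} {Ω : TopologicalSpace.Opens (Space n)} {φ : Space n → ℂ}
    (hφ : ContDiffOn ℝ ∞ φ Ω) : IsModerate Ω (fun _ => φ) := by
  refine ⟨fun _ => hφ, fun K hK hKΩ k w => ?_⟩
  have hc : ContinuousOn (fun x => ‖iteratedFDeriv ℝ k φ x‖) K := by
    have h1 : ContinuousOn (iteratedFDerivWithin ℝ k φ Ω) Ω :=
      hφ.continuousOn_iteratedFDerivWithin (by exact_mod_cast le_top) Ω.isOpen.uniqueDiffOn
    have h2 : ContinuousOn (iteratedFDeriv ℝ k φ) Ω :=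
      h1.congr fun x hx => (iteratedFDerivWithin_of_isOpen k Ω.isOpen hx).symm
    exact (h2.mono hKΩ).norm
  obtain ⟨B, hB⟩ := (hK.image_of_continuousOn hc).bddAbove
  refine ⟨0, max B 1, lt_max_of_lt_right one_pos, ⟨1, one_pos, le_rfl⟩, fun ε _ x hx => ?_⟩
  have : ‖iteratedFDeriv ℝ k φ x‖ ≤ B := hB ⟨x, hx, rfl⟩
  simpa using Or.inl ((norm_pderiv_le w φ x).trans this)

theorem IsModerate.add {n : ℕ} {Ω : TopologicalSpace.Opens (Space n)} {u v : Net n}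
    (hu : IsModerate Ω u) (hv : IsModerate Ω v) : IsModerate Ω (u + v) := by
  refine ⟨fun ε => (hu.1 ε).add (hv.1 ε), fun K hK hKΩ k w => ?_⟩
  obtain ⟨m, hm⟩ := hu.bd hK hKΩ k
  obtain ⟨m', hm'⟩ := hv.bd hK hKΩ k
  exact ⟨max m m', (Bd.add hu.1 hv.1 hKΩ ((hm k le_rfl).mono (by omega))
    ((hm' k le_rfl).mono (by omega))).pderiv w⟩

theorem IsModerate.mul {n : ℕ} {Ω : TopologicalSpace.Opens (Space n)} {u v : Net n}
    (hu : IsModerate Ω u) (hv : IsModerate Ω v) : IsModerate Ω (u * v) := by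
  refine ⟨fun ε => (hu.1 ε).mul (hv.1 ε), fun K hK hKΩ k w => ?_⟩
  obtain ⟨m, hm⟩ := hu.bd hK hKΩ k
  obtain ⟨m', hm'⟩ := hv.bd hK hKΩ k
  exact ⟨m + m', ((Bd.mul hu.1 hv.1 hKΩ hm hm').mono (by omega)).pderiv w⟩

/-! ### The Colombeau algebra -/

/-- The algebra of moderate nets on `Ω`. -/
def moderate {n : ℕ} (Ω : TopologicalSpace.Opens (Space n)) : Subalgebra ℂ (Net n) where
  carrier := {u | IsModerate Ω u}
  add_mem' := fun hu hv => IsModerate.add hu hv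
  mul_mem' := fun hu hv => IsModerate.mul hu hv
  algebraMap_mem' := fun _ => isModerate_const contDiffOn_const

/-- The ideal of negligible nets on `Ω`. -/
def negligible {n : ℕ} (Ω : TopologicalSpace.Opens (Space n)) : Ideal (moderate Ω) where
  carrier := {u | IsNegligible Ω u}
  zero_mem' := fun K _ _ k w m =>
    ⟨1, one_pos, ⟨1, one_pos, le_rfl⟩, fun ε _ x _ => by
      have h0 : pderiv w (((0 : moderate Ω) : Net n) ε) x = 0 := by
        change iteratedFDeriv ℝ k (0 : Space n → ℂ) x _ = 0
        simp
      rw [h0, norm_zero, one_mul]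
      exact zpow_nonneg ε.2.1.le _⟩
  add_mem' := fun {u v} hu hv K hK hKΩ k w m =>
    (Bd.add u.2.1 v.2.1 hKΩ (IsNegligible.bd hu hK hKΩ k m)
      (IsNegligible.bd hv hK hKΩ k m)).pderiv w
  smul_mem' := fun u v hv K hK hKΩ k w m => by
    obtain ⟨m', hm'⟩ := u.2.bd hK hKΩ k
    have h := Bd.mul u.2.1 v.2.1 hKΩ hm' (fun j _ => IsNegligible.bd hv hK hKΩ j (m + m'))
    exact (h.mono (by push_cast; omega)).pderiv w

/-- The Colombeau algebra `𝒢(Ω)`. Functions are represented by functions on `ℝⁿ`, but two nets that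
agree on `Ω` have the same class. -/
abbrev Colombeau {n : ℕ} (Ω : TopologicalSpace.Opens (Space n)) : Type :=
  moderate Ω ⧸ negligible Ω

/-- The class of a moderate net. -/
abbrev cl {n : ℕ} {Ω : TopologicalSpace.Opens (Space n)} (u : moderate Ω) : Colombeau Ω :=
  Ideal.Quotient.mk (negligible Ω) u

/-- The class of a smooth function, as a constant net. -/
def ofSmooth {n : ℕ} {Ω : TopologicalSpace.Opens (Space n)} (φ : Space n → ℂ)
    (hφ : ContDiffOn ℝ ∞ φ Ω) : Colombeau Ω :=
  cl ⟨fun _ => φ, isModerate_const hφ⟩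

theorem IsModerate.mono {n : ℕ} {Ω Ω' : TopologicalSpace.Opens (Space n)} (h : Ω' ≤ Ω) {u : Net n}
    (hu : IsModerate Ω u) : IsModerate Ω' u :=
  ⟨fun ε => (hu.1 ε).mono h, fun K hK hKΩ => hu.2 K hK (hKΩ.trans h)⟩

/-- Restriction of generalized functions to a smaller open set. -/
def restrict {n : ℕ} {Ω Ω' : TopologicalSpace.Opens (Space n)} (h : Ω' ≤ Ω) :
    Colombeau Ω →+* Colombeau Ω' :=
  Ideal.quotientMap (negligible Ω')
    (Subalgebra.inclusion (show moderate Ω ≤ moderate Ω' from fun _ hu => IsModerate.mono h hu) :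
      moderate Ω →+* moderate Ω')
    (fun _ hu => fun K hK hKΩ => hu K hK (hKΩ.trans h))

/-! ### Ultradifferentiable functions -/

/-- The standing assumptions on the sequence `M`: it is positive with `M 0 = 1`, logarithmically
convex (H1), stable under ultradifferential operators (H2) and non-quasi-analytic (H3)'. -/
structure IsWeightSequence (M : ℕ → ℝ) : Prop where
  pos : ∀ p, 0 < M p
  zero : M 0 = 1
  logConvex : ∀ p, M (p + 1) ^ 2 ≤ M p * M (p + 2)
  stable : ∃ A : ℝ, 0 < A ∧ ∃ H : ℝ, 0 < H ∧
    ∀ p q : ℕ, q ≤ p → M p ≤ A * H ^ p * M q * M (p - q)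
  nonQuasiAnalytic : Summable fun p : ℕ => M p / M (p + 1)

/-- The associated function `M̃(t) = sup_p ln (t^p / M_p)`, `t > 0`. -/
def associatedFunction (M : ℕ → ℝ) (t : ℝ) : ℝ :=
  ⨆ p : ℕ, Real.log (t ^ p / M p)

/-- The Denjoy-Carleman class `ℰ^M(Ω)`. -/
def denjoyCarleman {n : ℕ} (M : ℕ → ℝ) (Ω : TopologicalSpace.Opens (Space n)) :
    Set (Space n → ℂ) :=
  {φ | ContDiffOn ℝ ∞ φ Ω ∧ ∀ K : Set (Space n), IsCompact K → K ⊆ Ω →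
    ∃ c : ℝ, 0 < c ∧ ∀ (k : ℕ) (w : Fin k → Fin n), ∀ x ∈ K,
      ‖pderiv w φ x‖ ≤ c ^ (k + 1) * M k}

/-- The space `𝒟^M(Ω)` of functions of class `M` with compact support in `Ω`. -/
def testFunctions {n : ℕ} (M : ℕ → ℝ) (Ω : TopologicalSpace.Opens (Space n)) :
    Set (Space n → ℂ) :=
  {φ | φ ∈ denjoyCarleman M Ω ∧ HasCompactSupport φ ∧ tsupport φ ⊆ Ω}

/-! ### Ultraregular generalized functions -/

/-- The set `𝒜` of sequences of nonnegative numbers bounded by an affine sequence. -/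
def affineSequences : Set (ℕ → ℝ≥0) :=
  {N | ∃ a b : ℝ≥0, ∀ m : ℕ, N m ≤ a * m + b}

/-- The nets of `𝒳^{M,R}(Ω)`: ultraregular moderate nets of class `M`. -/
def IsUltraregularNet {n : ℕ} (M : ℕ → ℝ) (R : Set (ℕ → ℝ≥0))
    (Ω : TopologicalSpace.Opens (Space n)) (u : Net n) : Prop :=
  (∀ ε, ContDiffOn ℝ ∞ (u ε) Ω) ∧
    ∀ K : Set (Space n), IsCompact K → K ⊆ Ω →
      ∃ N ∈ R, ∃ C : ℝ, 0 < C ∧ ∃ ε₀ : Eps, ∀ (k : ℕ) (w : Fin k → Fin n),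
        ∀ ε : Eps, ε ≤ ε₀ → ∀ x ∈ K,
          ‖pderiv w (u ε) x‖ ≤ C ^ (k + 1) * M k * (ε : ℝ) ^ (-(N k : ℝ))

/-- The image of `𝒢^{M,R}(Ω)` in `𝒢(Ω)`: the classes having an ultraregular representative. -/
def ultraregular {n : ℕ} (M : ℕ → ℝ) (R : Set (ℕ → ℝ≥0))
    (Ω : TopologicalSpace.Opens (Space n)) : Set (Colombeau Ω) :=
  {f | ∃ u : moderate Ω, cl u = f ∧ IsUltraregularNet M R Ω u}

/-- The `(M,R)`-singular support: the complement in `Ω` of the largest open set on which `f` is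
ultraregular. -/
def singsupp {n : ℕ} (M : ℕ → ℝ) (R : Set (ℕ → ℝ≥0)) {Ω : TopologicalSpace.Opens (Space n)}
    (f : Colombeau Ω) : Set (Space n) :=
  (Ω : Set (Space n)) \
    (sSup {Ω' : TopologicalSpace.Opens (Space n) |
      ∃ h : Ω' ≤ Ω, restrict h f ∈ ultraregular M R Ω'} : TopologicalSpace.Opens (Space n))

/-! ### Affine singular directions -/

/-- The Fourier transform `∫ exp (-i x·ξ) f(x) dx`; Mathlib's kernel is `exp (-2πi x·ξ)`. -/
def fourierTransform {n : ℕ} (f : Space n → ℂ) (ξ : Space n) : ℂ :=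
  FourierTransform.fourier f ((2 * Real.pi)⁻¹ • ξ)

/-- `Γ` is a conic neighborhood of `ξ` in `ℝⁿ \ {0}`. -/
def IsConicNhd {n : ℕ} (Γ : Set (Space n)) (ξ : Space n) : Prop :=
  IsOpen Γ ∧ ξ ∈ Γ ∧ (0 : Space n) ∉ Γ ∧ ∀ η ∈ Γ, ∀ t : ℝ, 0 < t → t • η ∈ Γ

/-- `u` is a representative of `f` whose members are supported in a common compact subset of `Ω`
(and are extended by zero to `ℝⁿ`). -/
def IsCompactRep {n : ℕ} {Ω : TopologicalSpace.Opens (Space n)} (u : moderate Ω)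
    (f : Colombeau Ω) : Prop :=
  cl u = f ∧ ∃ K : Set (Space n), IsCompact K ∧ K ⊆ Ω ∧ ∀ ε : Eps, tsupport ((u : Net n) ε) ⊆ K

/-- The cone `Σ^M_𝒜(f)` of a generalized function `f` with compact support: the complement in
`ℝⁿ \ {0}` of the set of directions with a conic neighborhood on which the Fourier transforms of some
compactly supported representative satisfy the affine estimate. -/
def singularCone {n : ℕ} (M : ℕ → ℝ) {Ω : TopologicalSpace.Opens (Space n)}
    (f : Colombeau Ω) : Set (Space n) :=
  {ξ₀ | ξ₀ ≠ 0 ∧ ¬ ∃ Γ : Set (Space n), IsConicNhd Γ ξ₀ ∧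
    ∃ u : moderate Ω, IsCompactRep u f ∧
    ∃ a : ℝ, 0 ≤ a ∧ ∃ b : ℝ, 0 ≤ b ∧ ∃ C : ℝ, 0 < C ∧ ∃ k : ℝ, 0 < k ∧ ∃ ε₀ : Eps,
      ∀ ε : Eps, ε ≤ ε₀ → ∀ ξ ∈ Γ,
        ‖fourierTransform ((u : Net n) ε) ξ‖ ≤
          C * (ε : ℝ) ^ (-b) * Real.exp (-associatedFunction M (k * (ε : ℝ) ^ a * ‖ξ‖))}

/-- The cone `Σ^M_{𝒜,x₀}(f)` of affine singular directions of class `M` of `f` at `x₀`. -/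
def singularConeAt {n : ℕ} (M : ℕ → ℝ) {Ω : TopologicalSpace.Opens (Space n)}
    (f : Colombeau Ω) (x₀ : Space n) : Set (Space n) :=
  ⋂ (φ : Space n → ℂ) (hφ : φ ∈ testFunctions M Ω) (_ : ∀ᶠ x in 𝓝 x₀, φ x = 1),
    singularCone M (ofSmooth φ hφ.1.1 * f)

end

end Ultraregular

/-! Since `exp (-M̃ t)` is the infimum of `M p / t ^ p`, the affine estimate on a cone amounts to
bounds `‖ξ‖ ^ p * ‖ĝ_ε ξ‖ ≤ C * L ^ p * M p * ε⁻¹ ^ (a * p + b)` for all `p` (`DecayOn`). For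
compactly supported nets these are the frequency side of ultraregular derivative bounds with affine
exponents. Passing from derivatives to frequencies costs the volume of the support; the way back
costs `n + 1` extra powers of `‖ξ‖` for integrability, which (H2) absorbs.

If `f` is ultraregular near `x₀`, multiply an ultraregular representative by a cut-off of class `M`.
By the Leibniz rule and `M i * M j ≤ M (i + j)` the product keeps its bounds, so its transform
decays in every direction.

Conversely, an empty cone at `x₀` gives, for each unit vector, some `ψ` equal to `1` near `x₀` and a
representative of `ψ f` decaying on a conic neighborhood. Finitely many smaller cones cover the
sphere, and one cut-off `φ` of class `M` lives where the corresponding `ψ` all equal `1`, so `φ ψ =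
φ`. Multiplication by `φ` is convolution in frequency and keeps the decay on the smaller cones
(`DecayOn.cutoff_mul`). This leaves finitely many representatives of the same `φ f`, each good on
its own cone. They are glued in frequency (`exists_ultraregular_of_decayOn`): at `ξ` use the
transform of a representative good at `ξ`, then invert. The result is ultraregular, and differs from
`φ f` by a negligible net because transforms of negligible compactly supported nets are small
uniformly in `ξ`.

Cut-offs of class `M` come from infinitely many mollifications at scales proportional to `M p / M (p
+ 1)`, summable by (H3)'. -/

open scoped ContDiff Topology NNReal FourierTransform

namespace Ultraregular

open MeasureTheory Filter

/-! ### Mollification at a given scale -/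

section Mollify

variable {n : ℕ} {F : Type*} [NormedAddCommGroup F] [NormedSpace ℝ F]

/-- A smooth probability density on `ℝⁿ`, supported in the unit ball. -/
noncomputable def mollifier (n : ℕ) : Space n → ℝ :=
  (⟨1 / 2, 1, by norm_num, by norm_num⟩ : ContDiffBump (0 : Space n)).normed volume

theorem mollifier_nonneg (y : Space n) : 0 ≤ mollifier n y := ContDiffBump.nonneg_normed _ _

theorem contDiff_mollifier : ContDiff ℝ ∞ (mollifier n) :=
  ContDiffBump.contDiff_normed (n := (⊤ : ℕ∞)) _

theorem continuous_mollifier : Continuous (mollifier n) := contDiff_mollifier.continuous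

theorem hasCompactSupport_mollifier : HasCompactSupport (mollifier n) :=
  ContDiffBump.hasCompactSupport_normed _

theorem integral_mollifier : ∫ y, mollifier n y = 1 := ContDiffBump.integral_normed _

theorem integrable_mollifier : Integrable (mollifier n) :=
  continuous_mollifier.integrable_of_hasCompactSupport hasCompactSupport_mollifier

theorem norm_lt_one_of_mollifier_ne_zero {y : Space n} (hy : mollifier n y ≠ 0) : ‖y‖ < 1 := by
  have h : y ∈ Function.support (mollifier n) := hy
  rw [mollifier, ContDiffBump.support_normed_eq] at h
  simpa using h

/-- The average of `f` at scale `a`. -/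
noncomputable def mollify (a : ℝ) (f : Space n → F) (x : Space n) : F :=
  ∫ y, mollifier n y • f (x - a • y)

theorem integrable_mollifier_smul {g : Space n → F} (hg : Continuous g) :
    Integrable fun y => mollifier n y • g y :=
  (continuous_mollifier.smul hg).integrable_of_hasCompactSupport
    hasCompactSupport_mollifier.smul_right

theorem norm_mollify_le {a B : ℝ} {f : Space n → F} (hB : ∀ x, ‖f x‖ ≤ B) (x : Space n) :
    ‖mollify a f x‖ ≤ B := by
  refine (norm_integral_le_of_norm_le (integrable_mollifier.mul_const B)
    (Eventually.of_forall fun y => ?_)).trans_eq ?_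
  · rw [norm_smul, Real.norm_of_nonneg (mollifier_nonneg y)]
    exact mul_le_mul_of_nonneg_left (hB _) (mollifier_nonneg y)
  · rw [integral_mul_const, integral_mollifier, one_mul]

/-- The mollifier lives in the unit ball, so the average at `x` sees `f` only within distance `a`.
-/
theorem mollify_eq_of_forall [CompleteSpace F] {a : ℝ} (ha : 0 ≤ a) {f : Space n → F} {x : Space n}
    {c : F} (h : ∀ z, dist z x ≤ a → f z = c) : mollify a f x = c := by
  have : mollify a f x = ∫ y, mollifier n y • c := by
    refine integral_congr_ae (Eventually.of_forall fun y => ?_)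
    by_cases hy : mollifier n y = 0
    · simp [hy]
    · have h1 := norm_lt_one_of_mollifier_ne_zero hy
      dsimp only
      rw [h]
      rw [dist_eq_norm, sub_sub_cancel_left, norm_neg, norm_smul, Real.norm_of_nonneg ha]
      nlinarith
  rw [this, integral_smul_const, integral_mollifier, one_smul]

theorem norm_mollify_sub_le [CompleteSpace F] {a L : ℝ} (ha : 0 ≤ a) {f : Space n → F}
    (hf : Continuous f) (hL : ∀ x y, ‖f x - f y‖ ≤ L * ‖x - y‖) (hL0 : 0 ≤ L) (x : Space n) :
    ‖mollify a f x - f x‖ ≤ a * L := by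
  have h1 : f x = ∫ y, mollifier n y • f x := by
    rw [integral_smul_const, integral_mollifier, one_smul]
  have h2 : mollify a f x - f x = ∫ y, mollifier n y • (f (x - a • y) - f x) := by
    conv_lhs => rw [h1, mollify]
    rw [← integral_sub (integrable_mollifier_smul (by fun_prop))
      (integrable_mollifier_smul (by fun_prop))]
    simp only [smul_sub]
  rw [h2]
  refine (norm_integral_le_of_norm_le (integrable_mollifier.mul_const (a * L))
    (Eventually.of_forall fun y => ?_)).trans_eq ?_
  · rw [norm_smul, Real.norm_of_nonneg (mollifier_nonneg y)]
    by_cases hy : mollifier n y = 0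
    · simp [hy]
    · have h3 := norm_lt_one_of_mollifier_ne_zero hy
      refine mul_le_mul_of_nonneg_left ((hL _ _).trans ?_) (mollifier_nonneg y)
      rw [sub_sub_cancel_left, norm_neg, norm_smul, Real.norm_of_nonneg ha]
      have : a * ‖y‖ ≤ a * 1 := mul_le_mul_of_nonneg_left h3.le ha
      nlinarith
  · rw [integral_mul_const, integral_mollifier, one_mul]

/-- The mollifier is Lipschitz and the difference vanishes off two unit balls. The estimate is in
`L¹` so that it pairs with a mere sup bound on `f`. -/
theorem exists_integral_mollifier_sub_le (n : ℕ) : ∃ c : ℝ, 0 < c ∧ ∀ v : Space n,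
    ∫ y, |mollifier n (y + v) - mollifier n y| ≤ c * ‖v‖ := by
  obtain ⟨K, hK⟩ := contDiff_mollifier.lipschitzWith_of_hasCompactSupport
    (hasCompactSupport_mollifier (n := n)) (by simp)
  set V : ℝ := volume.real (Metric.closedBall (0 : Space n) 1) with hV
  refine ⟨K * (V + V) + 1, by positivity, fun v => ?_⟩
  set s : Set (Space n) := Metric.closedBall 0 1 ∪ Metric.closedBall (-v) 1 with hs
  have hzero : ∀ y ∉ s, |mollifier n (y + v) - mollifier n y| = 0 := by
    intro y hy
    rw [hs, Set.mem_union, not_or] at hy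
    have h1 : mollifier n y = 0 := by
      by_contra h
      exact hy.1 (by simpa using (norm_lt_one_of_mollifier_ne_zero h).le)
    have h2 : mollifier n (y + v) = 0 := by
      by_contra h
      exact hy.2 (by simpa [dist_eq_norm] using (norm_lt_one_of_mollifier_ne_zero h).le)
    simp [h1, h2]
  have hsfin : volume s < ⊤ := by
    refine (measure_union_le _ _).trans_lt (ENNReal.add_lt_top.2 ⟨?_, ?_⟩) <;>
      exact measure_closedBall_lt_top
  rw [← setIntegral_eq_integral_of_forall_compl_eq_zero (s := s) hzero]
  have h3 : ‖∫ y in s, |mollifier n (y + v) - mollifier n y|‖ ≤ (K * ‖v‖) * volume.real s := by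
    refine norm_setIntegral_le_of_norm_le_const hsfin fun y _ => ?_
    rw [Real.norm_eq_abs, abs_abs, ← Real.norm_eq_abs]
    simpa using hK.norm_sub_le (y + v) y
  have h4 : volume.real s ≤ V + V := by
    refine (measureReal_union_le _ _).trans_eq ?_
    rw [hV, Measure.real, Measure.real, Measure.addHaar_closedBall_center volume (-v)]
  have h5 := (le_abs_self _).trans h3
  have h6 : (K * ‖v‖) * volume.real s ≤ (K * ‖v‖) * (V + V) :=
    mul_le_mul_of_nonneg_left h4 (by positivity)
  nlinarith [norm_nonneg v]

/-- The `L¹`-Lipschitz constant of the mollifier. -/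
noncomputable def mollifierConst (n : ℕ) : ℝ := (exists_integral_mollifier_sub_le n).choose

theorem mollifierConst_pos : 0 < mollifierConst n := (exists_integral_mollifier_sub_le n).choose_spec.1

theorem integral_mollifier_sub_le (v : Space n) :
    ∫ y, |mollifier n (y + v) - mollifier n y| ≤ mollifierConst n * ‖v‖ :=
  (exists_integral_mollifier_sub_le n).choose_spec.2 v

/-- Translating the variable by `a⁻¹ • h` moves the increment from `f` to the mollifier: one
derivative is gained at the price of a factor proportional to `1 / a`. -/
theorem norm_mollify_add_sub_le {a B : ℝ} (ha : 0 < a) {f : Space n → F} (hf : Continuous f)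
    (hB : ∀ x, ‖f x‖ ≤ B) (x h : Space n) :
    ‖mollify a f (x + h) - mollify a f x‖ ≤ mollifierConst n / a * B * ‖h‖ := by
  have hB0 : 0 ≤ B := (norm_nonneg _).trans (hB 0)
  have hi : Integrable fun y => mollifier n (y + a⁻¹ • h) • f (x - a • y) := by
    have := (integrable_mollifier_smul (n := n) (g := fun y => f (x + h - a • y))
      (by fun_prop)).comp_add_right (a⁻¹ • h)
    refine this.congr (Eventually.of_forall fun y => ?_)
    simp [smul_smul, ha.ne']
  have h1 : mollify a f (x + h) = ∫ y, mollifier n (y + a⁻¹ • h) • f (x - a • y) := by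
    rw [mollify, ← integral_add_right_eq_self _ (a⁻¹ • h)]
    refine integral_congr_ae (Eventually.of_forall fun y => ?_)
    simp [smul_smul, ha.ne']
  rw [h1, mollify, ← integral_sub hi (integrable_mollifier_smul (by fun_prop))]
  have hint : Integrable fun y => |mollifier n (y + a⁻¹ • h) - mollifier n y| :=
    ((integrable_mollifier.comp_add_right _).sub integrable_mollifier).abs
  refine (norm_integral_le_of_norm_le (hint.mul_const B)
    (Eventually.of_forall fun y => ?_)).trans ?_
  · rw [← sub_smul, norm_smul, Real.norm_eq_abs]
    exact mul_le_mul_of_nonneg_left (hB _) (abs_nonneg _)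
  · rw [integral_mul_const]
    refine (mul_le_mul_of_nonneg_right (integral_mollifier_sub_le _) hB0).trans_eq ?_
    rw [norm_smul, norm_inv, Real.norm_of_nonneg ha.le]
    ring

theorem norm_fderiv_mollify_le {a B : ℝ} (ha : 0 < a) {f : Space n → F} (hf : Continuous f)
    (hB : ∀ x, ‖f x‖ ≤ B) (x : Space n) :
    ‖fderiv ℝ (mollify a f) x‖ ≤ mollifierConst n / a * B := by
  have hB0 : 0 ≤ B := (norm_nonneg _).trans (hB 0)
  refine norm_fderiv_le_of_lip' ℝ (mul_nonneg (div_nonneg mollifierConst_pos.le ha.le) hB0)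
    (Eventually.of_forall fun y => ?_)
  simpa using norm_mollify_add_sub_le ha hf hB x (y - x)

theorem hasFDerivAt_mollify {a B : ℝ} {f : Space n → F} (hf : ContDiff ℝ 1 f)
    (hB : ∀ x, ‖fderiv ℝ f x‖ ≤ B) (x : Space n) :
    HasFDerivAt (mollify a f) (mollify a (fderiv ℝ f) x) x := by
  have hc := hf.continuous
  have hc' := hf.continuous_fderiv one_ne_zero
  refine hasFDerivAt_integral_of_dominated_of_fderiv_le (s := Set.univ)
    (F' := fun x y => mollifier n y • fderiv ℝ f (x - a • y))
    (bound := fun y => mollifier n y * B) univ_mem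
    (Eventually.of_forall fun z => ?_) ?_ ?_ (Eventually.of_forall fun y z _ => ?_)
    (integrable_mollifier.mul_const B) (Eventually.of_forall fun y z _ => ?_)
  · exact (continuous_mollifier.smul (by fun_prop)).aestronglyMeasurable
  · exact integrable_mollifier_smul (by fun_prop)
  · exact (integrable_mollifier_smul (g := fun y => fderiv ℝ f (x - a • y))
      (hc'.comp (by fun_prop))).1
  · rw [norm_smul, Real.norm_of_nonneg (mollifier_nonneg y)]
    exact mul_le_mul_of_nonneg_left (hB _) (mollifier_nonneg y)
  · have h := ((hf.differentiable one_ne_zero) (z - a • y)).hasFDerivAt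
    have h' := h.comp z ((hasFDerivAt_id z).sub_const (a • y))
    exact h'.const_smul (mollifier n y)

/-- Smooth functions all of whose derivatives are bounded. -/
def BoundedSmooth (f : Space n → F) : Prop :=
  ContDiff ℝ ∞ f ∧ ∀ k, ∃ B : ℝ, ∀ x, ‖iteratedFDeriv ℝ k f x‖ ≤ B

theorem iteratedFDeriv_mollify {a : ℝ} {f : Space n → F} (hf : BoundedSmooth f) (k : ℕ) :
    iteratedFDeriv ℝ k (mollify a f) = mollify a (iteratedFDeriv ℝ k f) := by
  induction k with
  | zero =>
    ext1 x
    rw [iteratedFDeriv_zero_eq_comp, iteratedFDeriv_zero_eq_comp]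
    exact (ContinuousLinearEquiv.integral_comp_comm
      (continuousMultilinearCurryFin0 ℝ (Space n) F).symm.toContinuousLinearEquiv
      (fun y => mollifier n y • f (x - a • y))).symm.trans
        (integral_congr_ae (Eventually.of_forall fun y => map_smul _ _ _))
  | succ k ih =>
    ext1 x
    rw [iteratedFDeriv_succ_eq_comp_left, iteratedFDeriv_succ_eq_comp_left, ih]
    obtain ⟨B, hB⟩ := hf.2 (k + 1)
    have hd : ContDiff ℝ 1 (iteratedFDeriv ℝ k f) :=
      hf.1.iteratedFDeriv_right (by exact_mod_cast le_top)
    have := (hasFDerivAt_mollify (a := a) hd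
      (fun x => norm_fderiv_iteratedFDeriv.trans_le (hB x)) x).fderiv
    rw [Function.comp_apply, this]
    exact (ContinuousLinearEquiv.integral_comp_comm (𝕜 := ℝ)
      (F := ContinuousMultilinearMap ℝ (fun _ : Fin (k + 1) => Space n) F)
      (continuousMultilinearCurryLeftEquiv ℝ (fun _ : Fin (k + 1) => Space n)
        F).symm.toContinuousLinearEquiv
      (fun y => mollifier n y • fderiv ℝ (iteratedFDeriv ℝ k f) (x - a • y))).symm.trans
        (integral_congr_ae (Eventually.of_forall fun y => map_smul _ _ _))

theorem BoundedSmooth.mollify {a : ℝ} {f : Space n → F} (hf : BoundedSmooth f) :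
    BoundedSmooth (mollify a f) := by
  refine ⟨contDiff_of_differentiable_iteratedFDeriv fun k _ x => ?_, fun k => ?_⟩
  · rw [iteratedFDeriv_mollify hf]
    obtain ⟨B, hB⟩ := hf.2 (k + 1)
    have hd : ContDiff ℝ 1 (iteratedFDeriv ℝ k f) :=
      hf.1.iteratedFDeriv_right (by exact_mod_cast le_top)
    exact (hasFDerivAt_mollify (a := a) hd
      (fun x => norm_fderiv_iteratedFDeriv.trans_le (hB x)) x).differentiableAt
  · obtain ⟨B, hB⟩ := hf.2 k
    exact ⟨B, fun x => by rw [iteratedFDeriv_mollify hf]; exact norm_mollify_le hB x⟩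

theorem norm_iteratedFDeriv_mollify_le {a B : ℝ} {f : Space n → F} (hf : BoundedSmooth f) {k : ℕ}
    (hB : ∀ x, ‖iteratedFDeriv ℝ k f x‖ ≤ B) (x : Space n) :
    ‖iteratedFDeriv ℝ k (mollify a f) x‖ ≤ B := by
  rw [iteratedFDeriv_mollify hf]
  exact norm_mollify_le hB x

theorem norm_iteratedFDeriv_succ_mollify_le {a B : ℝ} (ha : 0 < a) {f : Space n → F}
    (hf : BoundedSmooth f) {k : ℕ} (hB : ∀ x, ‖iteratedFDeriv ℝ k f x‖ ≤ B) (x : Space n) :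
    ‖iteratedFDeriv ℝ (k + 1) (mollify a f) x‖ ≤ mollifierConst n / a * B := by
  rw [← norm_fderiv_iteratedFDeriv, iteratedFDeriv_mollify hf]
  exact norm_fderiv_mollify_le ha (hf.1.continuous_iteratedFDeriv (by exact_mod_cast le_top)) hB x

/-- Mean value inequality for the `k`-th derivative. For summable scales it makes the iterated
mollifications converge with all derivatives. -/
theorem norm_iteratedFDeriv_mollify_sub_le [CompleteSpace F] {a B : ℝ} (ha : 0 ≤ a)
    {f : Space n → F} (hf : BoundedSmooth f) {k : ℕ}
    (hB : ∀ x, ‖iteratedFDeriv ℝ (k + 1) f x‖ ≤ B) (x : Space n) :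
    ‖iteratedFDeriv ℝ k (mollify a f) x - iteratedFDeriv ℝ k f x‖ ≤ a * B := by
  have hd : ContDiff ℝ 1 (iteratedFDeriv ℝ k f) :=
    hf.1.iteratedFDeriv_right (by exact_mod_cast le_top)
  rw [iteratedFDeriv_mollify hf]
  refine norm_mollify_sub_le ha hd.continuous (fun y z => ?_) ((norm_nonneg _).trans (hB 0)) x
  exact Convex.norm_image_sub_le_of_norm_fderiv_le (𝕜 := ℝ) (s := Set.univ)
    (fun w _ => hd.differentiable one_ne_zero w)
    (fun w _ => norm_fderiv_iteratedFDeriv.trans_le (hB w)) convex_univ trivial trivial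

end Mollify

/-! ### Weight sequences -/

namespace IsWeightSequence

variable {M : ℕ → ℝ}

theorem ratio_pos (hM : IsWeightSequence M) (p : ℕ) : 0 < M p / M (p + 1) :=
  div_pos (hM.pos p) (hM.pos (p + 1))

theorem ratio_succ_le (hM : IsWeightSequence M) (p : ℕ) :
    M (p + 1) / M (p + 2) ≤ M p / M (p + 1) := by
  rw [div_le_div_iff₀ (hM.pos _) (hM.pos _), ← sq]
  exact hM.logConvex p

theorem antitone_ratio (hM : IsWeightSequence M) : Antitone fun p => M p / M (p + 1) :=
  antitone_nat_of_succ_le hM.ratio_succ_le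

/-- By (H1) the ratios `M p / M (p + 1)` decrease, which drives an induction on `i`. It keeps
Leibniz sums within class `M`. -/
theorem mul_le (hM : IsWeightSequence M) (i j : ℕ) : M i * M j ≤ M (i + j) := by
  induction i with
  | zero => simp [hM.zero]
  | succ i ih =>
    have h : M (i + j) / M (i + j + 1) ≤ M i / M (i + 1) := hM.antitone_ratio (by omega)
    rw [div_le_div_iff₀ (hM.pos _) (hM.pos _)] at h
    have hpos := hM.pos i
    have e : i + 1 + j = i + j + 1 := by omega
    rw [e]
    refine le_of_mul_le_mul_left ?_ hpos
    calc M i * (M (i + 1) * M j) = M (i + 1) * (M i * M j) := by ring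
      _ ≤ M (i + 1) * M (i + j) := mul_le_mul_of_nonneg_left ih (hM.pos _).le
      _ ≤ M i * M (i + j + 1) := by linarith

/-- Consecutive terms have ratio `t * M p / M (p + 1)`, which tends to `0` by (H3)'. So the supremum
defining `M̃` is a true one and not the default value of `⨆`. -/
theorem bddAbove_pow_div (hM : IsWeightSequence M) {t : ℝ} (ht : 0 < t) :
    BddAbove (Set.range fun p : ℕ => t ^ p / M p) := by
  have hs : Summable fun p : ℕ => t ^ p / M p := by
    refine summable_of_ratio_test_tendsto_lt_one (l := 0) one_pos
      (Eventually.of_forall fun p => (div_pos (pow_pos ht p) (hM.pos p)).ne') ?_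
    have h := hM.nonQuasiAnalytic.tendsto_atTop_zero.const_mul t
    rw [mul_zero] at h
    refine h.congr fun p => ?_
    rw [Real.norm_of_nonneg (div_pos (pow_pos ht _) (hM.pos _)).le,
      Real.norm_of_nonneg (div_pos (pow_pos ht _) (hM.pos _)).le]
    have := (hM.pos p).ne'
    have := (hM.pos (p + 1)).ne'
    have := ht.ne'
    field_simp
    ring
  exact hs.tendsto_atTop_zero.bddAbove_range

/-- The weight `exp (-M̃ t)` is bounded by every `M p / t ^ p`. -/
theorem pow_mul_exp_neg_associatedFunction_le (hM : IsWeightSequence M) {t : ℝ} (ht : 0 ≤ t)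
    (p : ℕ) : t ^ p * Real.exp (-associatedFunction M t) ≤ M p := by
  rcases ht.eq_or_lt with rfl | ht
  · rcases p with _ | p
    -- With `Real.log 0 = 0`, the terms `p > 0` vanish, and so does `p = 0` because `M 0 = 1`.
    · have h0 : associatedFunction M 0 = 0 := by
        have : ∀ p : ℕ, Real.log (0 ^ p / M p) = 0 := by
          rintro (_ | p) <;> simp [hM.zero]
        simp [associatedFunction, this]
      simp [h0, hM.zero]
    · simpa using (hM.pos _).le
  · have hb : BddAbove (Set.range fun p : ℕ => Real.log (t ^ p / M p)) := by
      obtain ⟨B, hB⟩ := hM.bddAbove_pow_div ht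
      refine ⟨B, ?_⟩
      rintro _ ⟨p, rfl⟩
      exact ((Real.log_le_sub_one_of_pos (div_pos (pow_pos ht p) (hM.pos p))).trans
        (by linarith)).trans (hB ⟨p, rfl⟩)
    have h := le_ciSup hb p
    have h' := Real.exp_le_exp.2 (neg_le_neg h)
    rw [Real.exp_neg (Real.log _), Real.exp_log (div_pos (pow_pos ht p) (hM.pos p)), inv_div] at h'
    calc _ ≤ t ^ p * (M p / t ^ p) := mul_le_mul_of_nonneg_left h' (pow_pos ht p).le
      _ = M p := mul_div_cancel₀ _ (pow_pos ht p).ne'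

/-- Conversely, a quantity bounded by every `D * M p / t ^ p` is bounded by `D * exp (-M̃ t)`. -/
theorem le_mul_exp_neg_associatedFunction (hM : IsWeightSequence M) {t X D : ℝ} (ht : 0 ≤ t)
    (hX : 0 ≤ X) (hD : 0 < D) (h : ∀ p : ℕ, t ^ p * X ≤ D * M p) :
    X ≤ D * Real.exp (-associatedFunction M t) := by
  rcases hX.eq_or_lt with rfl | hX
  · positivity
  have hXD : X ≤ D := by simpa [hM.zero] using h 0
  have hs : associatedFunction M t ≤ Real.log (D / X) := by
    refine ciSup_le fun p => ?_
    rcases (pow_nonneg ht p).eq_or_lt with h0 | h0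
    -- The default `Real.log 0 = 0` is harmless: the case `p = 0` of the hypothesis gives `X ≤ D`.
    · rw [← h0, zero_div, Real.log_zero]
      exact Real.log_nonneg ((one_le_div hX).2 hXD)
    · refine Real.log_le_log (div_pos h0 (hM.pos p)) ?_
      rw [div_le_div_iff₀ (hM.pos p) hX]
      exact h p
  have h1 := Real.exp_le_exp.2 (neg_le_neg hs)
  rw [Real.exp_neg (Real.log _), Real.exp_log (div_pos hD hX), inv_div] at h1
  calc X = D * (X / D) := by field_simp
    _ ≤ _ := mul_le_mul_of_nonneg_left h1 hD.le

end IsWeightSequence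

/-! ### Cut-off functions of class `M` -/

section Bump

variable {n : ℕ}

theorem boundedSmooth_of_hasCompactSupport {f : Space n → ℂ} (hf : ContDiff ℝ ∞ f)
    (hc : HasCompactSupport f) : BoundedSmooth f :=
  ⟨hf, fun k => (hc.iteratedFDeriv k).exists_bound_of_continuous
    (hf.continuous_iteratedFDeriv (by exact_mod_cast le_top))⟩

/-- Iterated mollification of `f`, at the scales `a 0, a 1, …`. -/
noncomputable def iterMollify (a : ℕ → ℝ) (f : Space n → ℂ) : ℕ → Space n → ℂ
  | 0 => f
  | N + 1 => mollify (a N) (iterMollify a f N)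

theorem BoundedSmooth.iterMollify {a : ℕ → ℝ} {f : Space n → ℂ} (hf : BoundedSmooth f) (N : ℕ) :
    BoundedSmooth (iterMollify a f N) := by
  induction N with
  | zero => exact hf
  | succ N ih => exact ih.mollify

/-- Each of the first `k` mollifications absorbs one derivative; the later ones do not increase the
sup norm. The bound is independent of `N` and so survives the limit. -/
theorem norm_iteratedFDeriv_iterMollify_le {a : ℕ → ℝ} (ha : ∀ j, 0 < a j) {f : Space n → ℂ}
    (hf : BoundedSmooth f) {B : ℝ} (hB : ∀ x, ‖f x‖ ≤ B) {k N : ℕ} (hkN : k ≤ N) (x : Space n) :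
    ‖iteratedFDeriv ℝ k (iterMollify a f N) x‖
      ≤ (∏ j ∈ Finset.range k, (mollifierConst n / a j)) * B := by
  have diag : ∀ k x, ‖iteratedFDeriv ℝ k (iterMollify a f k) x‖
      ≤ (∏ j ∈ Finset.range k, (mollifierConst n / a j)) * B := by
    intro k
    induction k with
    | zero => intro x; simpa [iterMollify] using hB x
    | succ k ih =>
      intro x
      rw [Finset.prod_range_succ, mul_comm (∏ j ∈ Finset.range k, _), mul_assoc]
      exact norm_iteratedFDeriv_succ_mollify_le (ha k) (hf.iterMollify k) ih x
  induction N, hkN using Nat.le_induction generalizing x with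
  | base => exact diag k x
  | succ N _ ih => exact norm_iteratedFDeriv_mollify_le (hf.iterMollify N) ih x

theorem iterMollify_eq_of_forall {a : ℕ → ℝ} (ha : ∀ j, 0 ≤ a j) {f : Space n → ℂ} {c : ℂ} (N : ℕ)
    (x : Space n) (h : ∀ z, dist z x ≤ ∑ j ∈ Finset.range N, a j → f z = c) :
    iterMollify a f N x = c := by
  induction N generalizing x with
  | zero => exact h x (by simp)
  | succ N ih =>
    refine mollify_eq_of_forall (ha N) fun z hz => ih z fun y hy => h y ?_
    rw [Finset.sum_range_succ]
    exact (dist_triangle y z x).trans (add_le_add hy hz)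

/-- If the scales are summable, iterated mollification converges to a smooth function. -/
theorem exists_limit_iterMollify {a : ℕ → ℝ} (ha : ∀ j, 0 < a j) (hs : Summable a)
    {f : Space n → ℂ} (hf : BoundedSmooth f) {B : ℝ} (hB : ∀ x, ‖f x‖ ≤ B) :
    ∃ g : Space n → ℂ, ContDiff ℝ ∞ g ∧
      (∀ x, Tendsto (fun N => iterMollify a f N x) atTop (𝓝 (g x))) ∧
      ∀ k x, ‖iteratedFDeriv ℝ k g x‖ ≤ (∏ j ∈ Finset.range k, (mollifierConst n / a j)) * B := by
  set φ := iterMollify a f with hφ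
  -- The sequence is written as a telescoping series, so that termwise differentiation of series
  -- applies.
  let d : ℕ → Space n → ℂ := fun i => Nat.casesOn i (φ 0) fun i => φ (i + 1) - φ i
  have hφs : ∀ N, BoundedSmooth (φ N) := fun N => hf.iterMollify N
  have hsum : ∀ N, ∑ i ∈ Finset.range (N + 1), d i = φ N := by
    intro N
    induction N with
    | zero => simp [d]
    | succ N ih => rw [Finset.sum_range_succ, ih]; simp [d]
  have hdc : ∀ i, ContDiff ℝ ∞ (d i) := by
    rintro (_ | i)
    · exact (hφs 0).1
    · exact (hφs (i + 1)).1.sub (hφs i).1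
  have hcd : ∀ (k N : ℕ) x, ContDiffAt ℝ k (φ N) x := fun k N x =>
    ((hφs N).1.of_le (by exact_mod_cast le_top)).contDiffAt
  have hDd : ∀ k i x, iteratedFDeriv ℝ k (d (i + 1)) x
      = iteratedFDeriv ℝ k (φ (i + 1)) x - iteratedFDeriv ℝ k (φ i) x := fun k i x =>
    iteratedFDeriv_sub_apply (hcd k (i + 1) x) (hcd k i x)
  have hv : ∀ k, ∃ v : ℕ → ℝ, Summable v ∧ ∀ i x, ‖iteratedFDeriv ℝ k (d i) x‖ ≤ v i := by
    intro k
    set c := (∏ j ∈ Finset.range (k + 1), (mollifierConst n / a j)) * B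
    have hb : ∀ i, ∃ b : ℝ, ∀ x, ‖iteratedFDeriv ℝ k (d i) x‖ ≤ b := by
      rintro (_ | i)
      · exact (hφs 0).2 k
      · obtain ⟨b, hb⟩ := (hφs (i + 1)).2 k
        obtain ⟨b', hb'⟩ := (hφs i).2 k
        refine ⟨b + b', fun x => ?_⟩
        rw [hDd]
        exact (norm_sub_le _ _).trans (add_le_add (hb x) (hb' x))
    choose b hb using hb
    -- The term `d (i + 1)` is compared with `a i` through the derivative of order `k + 1` of `φ i`,
    -- whose uniform bound needs `k + 1 ≤ i`; earlier terms are merely bounded.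
    refine ⟨fun i => if i < k + 2 then b i else a (i - 1) * c, ?_, fun i x => ?_⟩
    · rw [← summable_nat_add_iff (k + 2)]
      have : Summable fun i => a (i + (k + 1)) * c := ((summable_nat_add_iff (k + 1)).2 hs).mul_right c
      refine this.congr fun i => ?_
      rw [if_neg (by omega)]
      rfl
    · dsimp only
      split_ifs with h
      · exact hb i x
      · obtain ⟨i, rfl⟩ : ∃ i', i = i' + 1 := ⟨i - 1, by omega⟩
        rw [hDd]
        exact norm_iteratedFDeriv_mollify_sub_le (ha i).le (hφs i)
          (fun x => norm_iteratedFDeriv_iterMollify_le ha hf hB (by omega) x) x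
  choose v hvs hv using hv
  have hlim : ∀ k x, Tendsto (fun N => iteratedFDeriv ℝ k (φ N) x) atTop
      (𝓝 (∑' i, iteratedFDeriv ℝ k (d i) x)) := by
    intro k x
    have h1 : HasSum (fun i => iteratedFDeriv ℝ k (d i) x) (∑' i, iteratedFDeriv ℝ k (d i) x) :=
      ((hvs k).of_norm_bounded fun i => hv k i x).hasSum
    have h2 := (tendsto_add_atTop_iff_nat 1).2 h1.tendsto_sum_nat
    refine h2.congr fun N => ?_
    rw [← hsum N, iteratedFDeriv_sum_apply]
    exact fun i _ => ((hdc i).of_le (by exact_mod_cast le_top)).contDiffAt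
  have hder : ∀ k x, iteratedFDeriv ℝ k (fun y => ∑' i, d i y) x
      = ∑' i, iteratedFDeriv ℝ k (d i) x := fun k x =>
    iteratedFDeriv_tsum_apply (N := ⊤) hdc (fun k _ => hvs k) (fun k i x _ => hv k i x) le_top x
  refine ⟨fun x => ∑' i, d i x,
    contDiff_tsum (N := ⊤) hdc (fun k _ => hvs k) (fun k i x _ => hv k i x), fun x => ?_,
    fun k x => ?_⟩
  · have h1 : HasSum (fun i => d i x) (∑' i, d i x) :=
      ((hvs 0).of_norm_bounded fun i => by simpa using hv 0 i x).hasSum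
    refine ((tendsto_add_atTop_iff_nat 1).2 h1.tendsto_sum_nat).congr fun N => ?_
    rw [← hsum N, Finset.sum_apply]
  · rw [hder]
    refine le_of_tendsto (hlim k x).norm ?_
    filter_upwards [eventually_ge_atTop k] with N hN
    exact norm_iteratedFDeriv_iterMollify_le ha hf hB hN x

/-- Cut-off functions of class `M` exist, since `M` is non-quasi-analytic. -/
theorem IsWeightSequence.exists_cutoff {M : ℕ → ℝ} (hM : IsWeightSequence M) {x₀ : Space n}
    {U : Set (Space n)} (hU : U ∈ 𝓝 x₀) :
    ∃ φ : Space n → ℂ, ContDiff ℝ ∞ φ ∧ HasCompactSupport φ ∧ tsupport φ ⊆ U ∧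
      (∀ᶠ x in 𝓝 x₀, φ x = 1) ∧
      ∃ c : ℝ, 0 < c ∧ ∀ k x, ‖iteratedFDeriv ℝ k φ x‖ ≤ c ^ (k + 1) * M k := by
  obtain ⟨r, hr, hrU⟩ := Metric.nhds_basis_closedBall.mem_iff.1 hU
  -- The initial bump is `1` up to radius `2ρ` and `0` beyond `3ρ`. Mollification moves values by at
  -- most `ρ` in total, so the limit is `1` up to `ρ` and `0` beyond `4ρ = r`.
  set ρ := r / 4 with hρ
  have hρ0 : 0 < ρ := by positivity
  set S := ∑' p, M p / M (p + 1) with hS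
  have hS0 : 0 ≤ S := tsum_nonneg fun p => (hM.ratio_pos p).le
  set s := ρ / (S + 1) with hs
  have hs0 : 0 < s := by positivity
  -- With these scales the product of the `1 / a j`, `j < k`, telescopes to `M k / s ^ k`, while `s`
  -- keeps their sum below `ρ`.
  let a : ℕ → ℝ := fun p => s * (M p / M (p + 1))
  have ha : ∀ p, 0 < a p := fun p => mul_pos hs0 (hM.ratio_pos p)
  have hasum : Summable a := hM.nonQuasiAnalytic.mul_left s
  have hale : ∀ N, ∑ j ∈ Finset.range N, a j ≤ ρ := by
    intro N
    refine (hasum.sum_le_tsum _ fun j _ => (ha j).le).trans ?_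
    rw [tsum_mul_left, ← hS, hs, div_mul_eq_mul_div, div_le_iff₀ (by positivity)]
    nlinarith
  let β : ContDiffBump x₀ := ⟨2 * ρ, 3 * ρ, by positivity, by linarith⟩
  let f : Space n → ℂ := fun x => (β x : ℂ)
  have hfs : ContDiff ℝ ∞ f := Complex.ofRealCLM.contDiff.comp β.contDiff
  have hfc : HasCompactSupport f := β.hasCompactSupport.comp_left Complex.ofReal_zero
  have hfB : ∀ x, ‖f x‖ ≤ 1 := fun x => by
    simpa [f, abs_of_nonneg (β.nonneg' x)] using β.le_one
  obtain ⟨φ, hφs, hlim, hφ⟩ := exists_limit_iterMollify ha hasum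
    (boundedSmooth_of_hasCompactSupport hfs hfc) hfB
  have hone : ∀ x ∈ Metric.closedBall x₀ ρ, φ x = 1 := by
    intro x hx
    refine tendsto_nhds_unique (hlim x) (tendsto_const_nhds.congr fun N => ?_)
    refine (iterMollify_eq_of_forall (fun j => (ha j).le) N x fun z hz => ?_).symm
    have h1 : dist z x₀ ≤ 2 * ρ := by
      have := dist_triangle z x x₀
      have := hale N
      have := Metric.mem_closedBall.1 hx
      linarith
    have h2 : β z = 1 := β.one_of_mem_closedBall h1
    simp [f, h2]
  have hzero : ∀ x ∉ Metric.closedBall x₀ r, φ x = 0 := by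
    intro x hx
    refine tendsto_nhds_unique (hlim x) (tendsto_const_nhds.congr fun N => ?_)
    refine (iterMollify_eq_of_forall (fun j => (ha j).le) N x fun z hz => ?_).symm
    have h1 : 3 * ρ ≤ dist z x₀ := by
      have := dist_triangle_left x x₀ z
      have := hale N
      have := not_le.1 (mt Metric.mem_closedBall.2 hx)
      linarith
    have h2 : β z = 0 := β.zero_of_le_dist h1
    simp [f, h2]
  have hts : tsupport φ ⊆ Metric.closedBall x₀ r :=
    closure_minimal (fun x hx => by_contra fun h => hx (hzero x h)) Metric.isClosed_closedBall
  refine ⟨φ, hφs, (isCompact_closedBall x₀ r).of_isClosed_subset (isClosed_tsupport φ) hts,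
    hts.trans hrU, ?_, ?_⟩
  · filter_upwards [Metric.closedBall_mem_nhds x₀ hρ0] with x hx using hone x hx
  · set q := mollifierConst n / s with hq
    have hq0 : 0 < q := div_pos mollifierConst_pos hs0
    have hprod : ∀ k, ∏ j ∈ Finset.range k, (mollifierConst n / a j) = q ^ k * M k := by
      intro k
      induction k with
      | zero => simp [hM.zero]
      | succ k ih =>
        rw [Finset.prod_range_succ, ih, pow_succ, hq]
        have := (hM.pos k).ne'
        have := (hM.pos (k + 1)).ne'
        have := hs0.ne'
        simp only [a]
        field_simp
    refine ⟨q + 1, by positivity, fun k x => (hφ k x).trans ?_⟩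
    rw [hprod, mul_one]
    refine mul_le_mul_of_nonneg_right ?_ (hM.pos k).le
    calc q ^ k ≤ (q + 1) ^ k := by gcongr; linarith
      _ ≤ (q + 1) ^ (k + 1) := pow_le_pow_right₀ (by linarith) (Nat.le_succ k)

end Bump

/-! ### Fourier estimates -/

section Fourier

variable {n : ℕ}

theorem continuous_fourier {w : Space n → ℂ} (hw : Integrable w) : Continuous (𝓕 w) :=
  VectorFourier.fourierIntegral_continuous Real.continuous_fourierChar
    (innerSL ℝ).continuous₂ hw

theorem integrable_inv_one_add_norm_pow (n : ℕ) :
    Integrable fun ξ : Space n => ((1 + ‖ξ‖) ^ (n + 1))⁻¹ := by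
  have h := integrable_one_add_norm (E := Space n) (μ := volume) (r := (n + 1 : ℕ)) (by simp)
  refine h.congr (Eventually.of_forall fun ξ => ?_)
  dsimp only
  rw [Real.rpow_neg (by positivity), Real.rpow_natCast]

/-- A constant bounding the integrals of functions with polynomial decay of order `n + 1`. -/
noncomputable def decayConst (n : ℕ) : ℝ := 2 ^ (n + 1) * ∫ ξ : Space n, ((1 + ‖ξ‖) ^ (n + 1))⁻¹

theorem decayConst_nonneg (n : ℕ) : 0 ≤ decayConst n :=
  mul_nonneg (by positivity) (integral_nonneg fun ξ => by positivity)

theorem one_add_pow_le {t : ℝ} (ht : 0 ≤ t) (q : ℕ) : (1 + t) ^ q ≤ 2 ^ q * (1 + t ^ q) := by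
  have h1 : 1 + t ≤ 2 * max 1 t := by
    have := le_max_left 1 t
    have := le_max_right 1 t
    linarith
  refine (pow_le_pow_left₀ (by positivity) h1 q).trans ?_
  rw [mul_pow]
  refine mul_le_mul_of_nonneg_left ?_ (by positivity)
  rcases le_total 1 t with h | h
  · rw [max_eq_right h]; linarith
  · rw [max_eq_left h, one_pow]; linarith [pow_nonneg ht q]

/-- The `n + 1` additional powers buy the integrable weight `(1 + ‖ξ‖) ^ (-(n + 1))` on `ℝⁿ`. -/
theorem norm_pow_mul_le_of_decay {G : Space n → ℂ} {k : ℕ} {d d' : ℝ}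
    (h : ∀ ξ, ‖ξ‖ ^ k * ‖G ξ‖ ≤ d) (h' : ∀ ξ, ‖ξ‖ ^ (k + n + 1) * ‖G ξ‖ ≤ d') (ξ : Space n) :
    ‖ξ‖ ^ k * ‖G ξ‖ ≤ 2 ^ (n + 1) * (d + d') * ((1 + ‖ξ‖) ^ (n + 1))⁻¹ := by
  rw [← div_eq_mul_inv, le_div_iff₀ (by positivity)]
  calc ‖ξ‖ ^ k * ‖G ξ‖ * (1 + ‖ξ‖) ^ (n + 1)
      ≤ ‖ξ‖ ^ k * ‖G ξ‖ * (2 ^ (n + 1) * (1 + ‖ξ‖ ^ (n + 1))) :=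
        mul_le_mul_of_nonneg_left (one_add_pow_le (norm_nonneg _) _) (by positivity)
    _ = 2 ^ (n + 1) * (‖ξ‖ ^ k * ‖G ξ‖ + ‖ξ‖ ^ (k + n + 1) * ‖G ξ‖) := by ring
    _ ≤ _ := mul_le_mul_of_nonneg_left (add_le_add (h ξ) (h' ξ)) (by positivity)

theorem integrable_pow_mul_of_decay {G : Space n → ℂ} (hG : AEStronglyMeasurable G) {k : ℕ}
    {d d' : ℝ} (h : ∀ ξ, ‖ξ‖ ^ k * ‖G ξ‖ ≤ d) (h' : ∀ ξ, ‖ξ‖ ^ (k + n + 1) * ‖G ξ‖ ≤ d') :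
    Integrable fun ξ => ‖ξ‖ ^ k * ‖G ξ‖ := by
  refine ((integrable_inv_one_add_norm_pow n).const_mul (2 ^ (n + 1) * (d + d'))).mono'
    ((continuous_norm.pow k).aestronglyMeasurable.mul hG.norm) (Eventually.of_forall fun ξ => ?_)
  rw [Real.norm_of_nonneg (by positivity)]
  exact norm_pow_mul_le_of_decay h h' ξ

theorem integral_pow_mul_le_of_decay {G : Space n → ℂ} (hG : AEStronglyMeasurable G) {k : ℕ}
    {d d' : ℝ} (h : ∀ ξ, ‖ξ‖ ^ k * ‖G ξ‖ ≤ d) (h' : ∀ ξ, ‖ξ‖ ^ (k + n + 1) * ‖G ξ‖ ≤ d') :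
    ∫ ξ, ‖ξ‖ ^ k * ‖G ξ‖ ≤ decayConst n * (d + d') := by
  refine (integral_mono (integrable_pow_mul_of_decay hG h h')
    ((integrable_inv_one_add_norm_pow n).const_mul (2 ^ (n + 1) * (d + d')))
    (norm_pow_mul_le_of_decay h h')).trans_eq ?_
  rw [integral_const_mul, decayConst]
  ring

/-- `G` decreases faster than any power. -/
def RapidDecay (G : Space n → ℂ) : Prop := ∀ p : ℕ, ∃ d : ℝ, ∀ ξ, ‖ξ‖ ^ p * ‖G ξ‖ ≤ d

theorem RapidDecay.integrable_pow_mul {G : Space n → ℂ} (h : RapidDecay G)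
    (hG : AEStronglyMeasurable G) (k : ℕ) : Integrable fun ξ => ‖ξ‖ ^ k * ‖G ξ‖ :=
  integrable_pow_mul_of_decay hG (h k).choose_spec (h (k + n + 1)).choose_spec

theorem RapidDecay.integrable {G : Space n → ℂ} (h : RapidDecay G)
    (hG : AEStronglyMeasurable G) : Integrable G :=
  (integrable_norm_iff hG).1 (by simpa using h.integrable_pow_mul hG 0)

/-- The inverse Fourier transform of a rapidly decreasing function is smooth. -/
theorem RapidDecay.contDiff_fourierInv {G : Space n → ℂ} (h : RapidDecay G)
    (hG : AEStronglyMeasurable G) : ContDiff ℝ ∞ (𝓕⁻ G) := by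
  rw [Real.fourierInv_eq_fourier_comp_neg]
  refine Real.contDiff_fourier (N := ⊤) fun p _ => ?_
  simpa using (h.integrable_pow_mul hG p).comp_neg

theorem RapidDecay.norm_iteratedFDeriv_fourierInv_le {G : Space n → ℂ} (h : RapidDecay G)
    (hG : AEStronglyMeasurable G) {k : ℕ} {d d' : ℝ} (hk : ∀ ξ, ‖ξ‖ ^ k * ‖G ξ‖ ≤ d)
    (hk' : ∀ ξ, ‖ξ‖ ^ (k + n + 1) * ‖G ξ‖ ≤ d') (x : Space n) :
    ‖iteratedFDeriv ℝ k (𝓕⁻ G) x‖ ≤ (2 * Real.pi) ^ k * (decayConst n * (d + d')) := by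
  have hi' : ∀ p, Integrable fun ξ => ‖ξ‖ ^ p * ‖G (-ξ)‖ := fun p => by
    simpa using (h.integrable_pow_mul hG p).comp_neg
  rw [Real.fourierInv_eq_fourier_comp_neg,
    Real.iteratedFDeriv_fourier (N := ⊤) (fun p _ => hi' p)
      (hG.comp_measurePreserving (Measure.measurePreserving_neg volume)) le_top]
  refine (VectorFourier.norm_fourierIntegral_le_integral_norm _ _ _ _ _).trans ?_
  calc _ ≤ ∫ ξ : Space n, (2 * Real.pi) ^ k * (‖ξ‖ ^ k * ‖G (-ξ)‖) := by
        refine integral_mono_of_nonneg (Eventually.of_forall fun ξ => norm_nonneg _)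
          ((hi' k).const_mul _) (Eventually.of_forall fun ξ => ?_)
        refine (VectorFourier.norm_fourierPowSMulRight_le _ _ _ _).trans
          ((mul_assoc _ _ _).trans_le (mul_le_mul_of_nonneg_right
            (pow_le_pow_left₀ (by positivity) ?_ k) (by positivity)))
        have := norm_innerSL_le (E := Space n) ℝ
        nlinarith [Real.pi_pos]
    _ = (2 * Real.pi) ^ k * ∫ ξ : Space n, ‖ξ‖ ^ k * ‖G ξ‖ := by
        rw [integral_const_mul]
        congr 1
        simpa using integral_neg_eq_self (fun ξ : Space n => ‖ξ‖ ^ k * ‖G ξ‖) volume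
    _ ≤ _ := mul_le_mul_of_nonneg_left (integral_pow_mul_le_of_decay hG hk hk')
        (by positivity)

/-- The Fourier transform of a test function decreases rapidly. -/
theorem norm_pow_mul_fourier_le {w : Space n → ℂ} (hw : ContDiff ℝ ∞ w) {K : Set (Space n)}
    (hK : IsCompact K) (hwK : tsupport w ⊆ K) {p : ℕ} {B : ℝ}
    (hB : ∀ x ∈ K, ‖iteratedFDeriv ℝ p w x‖ ≤ B) (ξ : Space n) :
    ‖ξ‖ ^ p * ‖𝓕 w ξ‖ ≤ B * volume.real K := by
  have hc : HasCompactSupport w := hK.of_isClosed_subset (isClosed_tsupport w) hwK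
  have hint : ∀ p, Integrable (iteratedFDeriv ℝ p w) := fun p =>
    (hw.continuous_iteratedFDeriv (by exact_mod_cast le_top)).integrable_of_hasCompactSupport
      (hc.iteratedFDeriv p)
  have h1 : ‖𝓕 (iteratedFDeriv ℝ p w) ξ‖ ≤ B * volume.real K := by
    refine (VectorFourier.norm_fourierIntegral_le_integral_norm _ _ _ _ _).trans ?_
    have h0 : ∀ x ∉ K, ‖iteratedFDeriv ℝ p w x‖ = 0 := fun x hx => by
      rw [norm_eq_zero]
      exact image_eq_zero_of_notMem_tsupport fun h =>
        hx (hwK (tsupport_iteratedFDeriv_subset p h))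
    rw [← setIntegral_eq_integral_of_forall_compl_eq_zero (s := K) h0]
    refine (Real.le_norm_self _).trans (norm_setIntegral_le_of_norm_le_const hK.measure_lt_top
      fun x hx => ?_)
    rw [norm_norm]
    exact hB x hx
  have h2 : (2 * Real.pi * ‖ξ‖) ^ p * ‖𝓕 w ξ‖ ≤ ‖𝓕 (iteratedFDeriv ℝ p w) ξ‖ := by
    rcases eq_or_ne ξ 0 with rfl | hξ
    · rcases p with _ | p
      · have := (𝓕 (iteratedFDeriv ℝ 0 w) 0).le_opNorm (fun _ => 0)
        rw [Real.fourier_iteratedFDeriv (N := ⊤) hw (fun p _ => hint p) le_top] at this ⊢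
        simpa [VectorFourier.fourierPowSMulRight_apply] using this
      · simp
    -- Testing on `ξ` in every slot produces `‖ξ‖ ^ (2 * p)` on the left and `‖ξ‖ ^ p` on the right;
    -- one factor `‖ξ‖ ^ p` cancels.
    · have := (𝓕 (iteratedFDeriv ℝ p w) ξ).le_opNorm (fun _ => ξ)
      rw [Real.fourier_iteratedFDeriv (N := ⊤) hw (fun p _ => hint p) le_top] at this ⊢
      rw [VectorFourier.fourierPowSMulRight_apply] at this
      simp only [norm_smul, norm_pow, norm_neg, norm_mul, Complex.norm_ofNat, Complex.norm_real,
        Complex.norm_I, mul_one, Finset.prod_const, Finset.card_univ, Fintype.card_fin,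
        neg_apply, Real.norm_of_nonneg Real.pi_pos.le] at this
      rw [show innerSL ℝ ξ ξ = ‖ξ‖ ^ 2 from real_inner_self_eq_norm_sq ξ,
        Real.norm_of_nonneg (sq_nonneg _)] at this
      have hpos : 0 < ‖ξ‖ ^ p := pow_pos (norm_pos_iff.2 hξ) p
      refine le_of_mul_le_mul_right (le_of_eq_of_le ?_ this) hpos
      ring
  refine le_trans ?_ (h2.trans h1)
  gcongr
  have := Real.pi_gt_three
  nlinarith [norm_nonneg ξ]

theorem rapidDecay_fourier {w : Space n → ℂ} (hw : ContDiff ℝ ∞ w) (hc : HasCompactSupport w) :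
    RapidDecay (𝓕 w) := fun p =>
  ⟨_, norm_pow_mul_fourier_le hw hc subset_rfl
    fun x _ => ((boundedSmooth_of_hasCompactSupport hw hc).2 p).choose_spec x⟩

theorem integrable_fourier_of_hasCompactSupport {w : Space n → ℂ} (hw : ContDiff ℝ ∞ w)
    (hc : HasCompactSupport w) : Integrable (𝓕 w) :=
  (rapidDecay_fourier hw hc).integrable (continuous_fourier
    (hw.continuous.integrable_of_hasCompactSupport hc)).aestronglyMeasurable

theorem fourierInv_fourier_of_hasCompactSupport {w : Space n → ℂ} (hw : ContDiff ℝ ∞ w)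
    (hc : HasCompactSupport w) : 𝓕⁻ (𝓕 w) = w :=
  hw.continuous.fourierInv_fourier_eq (hw.continuous.integrable_of_hasCompactSupport hc)
    (integrable_fourier_of_hasCompactSupport hw hc)

theorem fourier_sub {f g : Space n → ℂ} (hf : Integrable f) (hg : Integrable g) (ξ : Space n) :
    𝓕 (f - g) ξ = 𝓕 f ξ - 𝓕 g ξ := by
  rw [Real.fourier_eq, Real.fourier_eq, Real.fourier_eq,
    ← integral_sub ((Real.fourierIntegral_convergent_iff ξ).2 hf)
      ((Real.fourierIntegral_convergent_iff ξ).2 hg)]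
  simp [smul_sub]

theorem fourierInv_sub {f g : Space n → ℂ} (hf : Integrable f) (hg : Integrable g) :
    𝓕⁻ (f - g) = 𝓕⁻ f - 𝓕⁻ g := by
  ext x
  simp only [Pi.sub_apply, Real.fourierInv_eq_fourier_neg, fourier_sub hf hg]

/-- The Fourier transform of a product is the convolution of the Fourier transforms. -/
theorem fourier_mul_eq_integral {φ g : Space n → ℂ} (hφ : Integrable φ) (hg : ContDiff ℝ ∞ g)
    (hgc : HasCompactSupport g) (ξ : Space n) :
    𝓕 (φ * g) ξ = ∫ η, 𝓕 φ (ξ - η) * 𝓕 g η := by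
  -- Chosen so that `𝓕 ψ η = 𝓕 φ (ξ - η)`. The self-adjointness of `𝓕` and `𝓕 (𝓕 g) x = g (-x)` then
  -- give the convolution formula.
  let ψ : Space n → ℂ := fun x => Real.fourierChar (inner ℝ x ξ) • φ (-x)
  have hψ : Integrable ψ := by
    have := (Real.fourierIntegral_convergent_iff (-ξ)).2 hφ.comp_neg
    simpa [ψ] using this
  have h1 : ∀ η, 𝓕 φ (ξ - η) = 𝓕 ψ η := by
    intro η
    rw [Real.fourier_eq, Real.fourier_eq, ← integral_neg_eq_self]
    refine integral_congr_ae (Eventually.of_forall fun x => ?_)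
    simp only [ψ, inner_neg_left, smul_smul, ← AddChar.map_add_eq_mul, inner_sub_right]
    congr 2
    ring
  have h2 := VectorFourier.integral_fourierIntegral_smul_eq_flip (L := innerₗ (Space n))
    (μ := volume) (ν := volume) (f := ψ) (g := 𝓕 g)
    Real.continuous_fourierChar (innerSL ℝ).continuous₂ hψ
    (integrable_fourier_of_hasCompactSupport hg hgc)
  have h3 : ∀ x, VectorFourier.fourierIntegral Real.fourierChar volume (innerₗ (Space n)).flip
      (𝓕 g) x = g (-x) := by
    intro x
    rw [flip_innerₗ]
    change 𝓕 (𝓕 g) x = _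
    rw [← neg_neg x, ← Real.fourierInv_eq_fourier_neg,
      fourierInv_fourier_of_hasCompactSupport hg hgc, neg_neg]
  simp only [h3, smul_eq_mul] at h2
  simp_rw [h1]
  refine Eq.trans ?_ h2.symm
  rw [Real.fourier_eq, ← integral_neg_eq_self]
  refine integral_congr_ae (Eventually.of_forall fun x => ?_)
  simp [ψ, Circle.smul_def, mul_assoc]

end Fourier

/-! ### Affine decay of class `M` -/

section Decay

variable {n : ℕ} {M : ℕ → ℝ}

/-- The affine estimate of class `M` on `S`, for a net of functions of the frequency, with the
associated function expressed through the powers it is the supremum of. -/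
def DecayOn (M : ℕ → ℝ) (G : Eps → Space n → ℂ) (S : Set (Space n)) : Prop :=
  ∃ a b : ℕ, ∃ C : ℝ, 0 < C ∧ ∃ L : ℝ, 0 < L ∧ ∃ ε₀ : Eps, ∀ ε : Eps, ε ≤ ε₀ → ∀ ξ ∈ S, ∀ p : ℕ,
    ‖ξ‖ ^ p * ‖G ε ξ‖ ≤ C * L ^ p * M p * ((ε : ℝ)⁻¹) ^ (a * p + b)

theorem one_le_inv_eps (ε : Eps) : 1 ≤ (ε : ℝ)⁻¹ := (one_le_inv₀ ε.2.1).2 ε.2.2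

theorem inv_eps_pow_eq_rpow (ε : Eps) (m : ℕ) : ((ε : ℝ)⁻¹) ^ m = (ε : ℝ) ^ (-(m : ℝ)) := by
  rw [Real.rpow_neg ε.2.1.le, Real.rpow_natCast, inv_pow]

theorem inv_eps_pow_eq_zpow (ε : Eps) (m : ℕ) : ((ε : ℝ)⁻¹) ^ m = (ε : ℝ) ^ (-(m : ℤ)) := by
  rw [zpow_neg, zpow_natCast, inv_pow]

/-- Mathlib's transform at `ξ` is `fourierTransform` at `(2 * π) • ξ`, which stays in the cone.
Since `ε ≤ 1`, the real exponents `a`, `b` may be rounded up to integers. -/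
theorem decayOn_of_associatedFunction (hM : IsWeightSequence M) {Γ : Set (Space n)}
    (hΓ : ∀ η ∈ Γ, ∀ t : ℝ, 0 < t → t • η ∈ Γ) {u : Net n} {a b C k : ℝ} (hC : 0 < C)
    (hk : 0 < k) {ε₀ : Eps} (h : ∀ ε : Eps, ε ≤ ε₀ → ∀ ξ ∈ Γ, ‖fourierTransform (u ε) ξ‖ ≤
      C * (ε : ℝ) ^ (-b) * Real.exp (-associatedFunction M (k * (ε : ℝ) ^ a * ‖ξ‖))) :
    DecayOn M (fun ε => 𝓕 (u ε)) Γ := by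
  have hpi := Real.pi_pos
  refine ⟨⌈a⌉₊, ⌈b⌉₊, C, hC, (k * (2 * Real.pi))⁻¹, by positivity, ε₀, fun ε hε ξ hξ p => ?_⟩
  have hε0 := ε.2.1
  have hs := h ε hε ((2 * Real.pi) • ξ) (hΓ ξ hξ _ (by positivity))
  rw [fourierTransform, smul_smul, inv_mul_cancel₀ (by positivity), one_smul, norm_smul,
    Real.norm_of_nonneg (by positivity)] at hs
  set κ := k * (ε : ℝ) ^ a * (2 * Real.pi) with hκ
  have hεa : 0 < (ε : ℝ) ^ a := Real.rpow_pos_of_pos hε0 a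
  have hκ0 : 0 < κ := by positivity
  have ht : k * (ε : ℝ) ^ a * (2 * Real.pi * ‖ξ‖) = κ * ‖ξ‖ := by rw [hκ]; ring
  rw [ht] at hs
  set E := Real.exp (-associatedFunction M (κ * ‖ξ‖)) with hE
  have hE1 : (κ * ‖ξ‖) ^ p * E ≤ M p :=
    hM.pow_mul_exp_neg_associatedFunction_le (by positivity) p
  have hb : (ε : ℝ) ^ (-b) ≤ ((ε : ℝ)⁻¹) ^ ⌈b⌉₊ := by
    rw [inv_eps_pow_eq_rpow]
    exact Real.rpow_le_rpow_of_exponent_ge hε0 ε.2.2 (neg_le_neg (Nat.le_ceil b))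
  have ha : ((ε : ℝ) ^ a)⁻¹ ≤ ((ε : ℝ)⁻¹) ^ ⌈a⌉₊ := by
    rw [inv_eps_pow_eq_rpow, ← Real.rpow_neg hε0.le]
    exact Real.rpow_le_rpow_of_exponent_ge hε0 ε.2.2 (neg_le_neg (Nat.le_ceil a))
  have hκinv : κ⁻¹ ≤ (k * (2 * Real.pi))⁻¹ * ((ε : ℝ)⁻¹) ^ ⌈a⌉₊ := by
    have : κ⁻¹ = (k * (2 * Real.pi))⁻¹ * ((ε : ℝ) ^ a)⁻¹ := by
      rw [hκ, ← mul_inv]; congr 1; ring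
    rw [this]
    gcongr
  have hMp := (hM.pos p).le
  have hinv : 0 < (ε : ℝ)⁻¹ := inv_pos.2 hε0
  calc ‖ξ‖ ^ p * ‖𝓕 (u ε) ξ‖ ≤ ‖ξ‖ ^ p * (C * (ε : ℝ) ^ (-b) * E) := by gcongr
    _ = C * (ε : ℝ) ^ (-b) * (κ⁻¹ ^ p * ((κ * ‖ξ‖) ^ p * E)) := by
        rw [mul_pow, inv_pow]; field_simp
    _ ≤ C * ((ε : ℝ)⁻¹) ^ ⌈b⌉₊ * (((k * (2 * Real.pi))⁻¹ * ((ε : ℝ)⁻¹) ^ ⌈a⌉₊) ^ p * M p) := by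
        gcongr
    _ = _ := by rw [mul_pow, ← pow_mul, pow_add]; ring

/-- The exponential weight is the infimum of the power weights, so the estimates for all `p`
together recover it. -/
theorem DecayOn.exists_associatedFunction_le (hM : IsWeightSequence M) {u : Net n}
    {S : Set (Space n)} (h : DecayOn M (fun ε => 𝓕 (u ε)) Set.univ) :
    ∃ a : ℝ, 0 ≤ a ∧ ∃ b : ℝ, 0 ≤ b ∧ ∃ C : ℝ, 0 < C ∧ ∃ k : ℝ, 0 < k ∧ ∃ ε₀ : Eps,
      ∀ ε : Eps, ε ≤ ε₀ → ∀ ξ ∈ S, ‖fourierTransform (u ε) ξ‖ ≤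
        C * (ε : ℝ) ^ (-b) * Real.exp (-associatedFunction M (k * (ε : ℝ) ^ a * ‖ξ‖)) := by
  obtain ⟨a, b, C, hC, L, hL, ε₀, H⟩ := h
  have hpi := Real.pi_pos
  refine ⟨a, by positivity, b, by positivity, C, hC, (2 * Real.pi * L)⁻¹, by positivity, ε₀,
    fun ε hε ξ _ => ?_⟩
  have hε0 := ε.2.1
  rw [← inv_eps_pow_eq_rpow, Real.rpow_natCast]
  refine hM.le_mul_exp_neg_associatedFunction (by positivity) (norm_nonneg _) (by positivity)
    fun p => ?_
  have h1 := H ε hε ((2 * Real.pi)⁻¹ • ξ) trivial p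
  rw [norm_smul, Real.norm_of_nonneg (by positivity)] at h1
  calc ((2 * Real.pi * L)⁻¹ * (ε : ℝ) ^ a * ‖ξ‖) ^ p * ‖fourierTransform (u ε) ξ‖
      = (L⁻¹ * (ε : ℝ) ^ a) ^ p * (((2 * Real.pi)⁻¹ * ‖ξ‖) ^ p *
          ‖𝓕 (u ε) ((2 * Real.pi)⁻¹ • ξ)‖) := by
        rw [fourierTransform, ← mul_assoc, ← mul_pow, mul_inv]; congr 2; ring
    _ ≤ (L⁻¹ * (ε : ℝ) ^ a) ^ p * (C * L ^ p * M p * ((ε : ℝ)⁻¹) ^ (a * p + b)) := by gcongr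
    _ = _ := by
        rw [pow_add, pow_mul, inv_pow, inv_pow, inv_pow, mul_pow, inv_pow]
        field_simp

/-- Estimates on finitely many sets can be joined. -/
theorem DecayOn.select (hM : IsWeightSequence M) {ι : Type*} [Finite ι]
    {G : ι → Eps → Space n → ℂ} {S : ι → Set (Space n)}
    (h : ∀ i, DecayOn M (G i) (S i)) {σ : Space n → ι} (hσ : ∀ ξ, ξ ∈ S (σ ξ)) :
    DecayOn M (fun ε ξ => G (σ ξ) ε ξ) Set.univ := by
  choose a b C hC L hL ε₀ H using h
  obtain ⟨a', ha'⟩ := Finite.exists_le a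
  obtain ⟨b', hb'⟩ := Finite.exists_le b
  obtain ⟨C', hC'⟩ := Finite.exists_le C
  obtain ⟨L', hL'⟩ := Finite.exists_le L
  have : Nonempty Eps := ⟨⟨1, one_pos, le_rfl⟩⟩
  obtain ⟨η, hη⟩ := Finite.exists_ge ε₀
  have i₀ := σ 0
  refine ⟨a', b', C', (hC i₀).trans_le (hC' i₀), L', (hL i₀).trans_le (hL' i₀), η,
    fun ε hε ξ _ p => (H (σ ξ) ε (hε.trans (hη _)) ξ (hσ ξ) p).trans ?_⟩
  have h1 := one_le_inv_eps ε
  have h2 := (hM.pos p).le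
  have h3 := (hC (σ ξ)).le
  have h4 := (hL (σ ξ)).le
  have h5 := h3.trans (hC' (σ ξ))
  have h6 := h4.trans (hL' (σ ξ))
  gcongr ?_ * ?_ ^ p * M p * ?_
  · exact hC' _
  · exact hL' _
  · exact pow_le_pow_right₀ h1 (add_le_add (Nat.mul_le_mul_right p (ha' _)) (hb' _))

/-- Derivative bounds of class `M` give affine decay of the Fourier transform. -/
theorem decayOn_fourier_of_bounds (hM : IsWeightSequence M) {u : Net n} {K : Set (Space n)}
    (hK : IsCompact K) (hu : ∀ ε, ContDiff ℝ ∞ (u ε)) (huK : ∀ ε, tsupport (u ε) ⊆ K)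
    {a b : ℕ} {C L : ℝ} (hC : 0 < C) (hL : 0 < L) {ε₀ : Eps}
    (H : ∀ ε : Eps, ε ≤ ε₀ → ∀ x ∈ K, ∀ p : ℕ, ‖iteratedFDeriv ℝ p (u ε) x‖
      ≤ C * L ^ p * M p * ((ε : ℝ)⁻¹) ^ (a * p + b)) :
    DecayOn M (fun ε => 𝓕 (u ε)) Set.univ := by
  have hV : 0 ≤ volume.real K := measureReal_nonneg
  refine ⟨a, b, C * (volume.real K + 1), by positivity, L, hL, ε₀, fun ε hε ξ _ p => ?_⟩
  refine (norm_pow_mul_fourier_le (hu ε) hK (huK ε) (fun x hx => H ε hε x hx p) ξ).trans ?_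
  have h1 := (hM.pos p).le
  have h2 := one_le_inv_eps ε
  have h3 : 0 ≤ C * L ^ p * M p * ((ε : ℝ)⁻¹) ^ (a * p + b) := by positivity
  nlinarith

theorem exists_fourier_le_of_bd {u : Net n} {K : Set (Space n)} (hK : IsCompact K)
    (hu : ∀ ε, ContDiff ℝ ∞ (u ε)) (huK : ∀ ε, tsupport (u ε) ⊆ K) {p : ℕ} {s : ℤ}
    (h : Bd K p s u) : ∃ C : ℝ, 0 < C ∧ ∃ η : Eps, ∀ ε : Eps, ε ≤ η → ∀ ξ,
      ‖ξ‖ ^ p * ‖𝓕 (u ε) ξ‖ ≤ C * (ε : ℝ) ^ s := by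
  obtain ⟨C, hC, η, H⟩ := h
  have hV : 0 ≤ volume.real K := measureReal_nonneg
  refine ⟨C * (volume.real K + 1), by positivity, η, fun ε hε ξ => ?_⟩
  refine (norm_pow_mul_fourier_le (hu ε) hK (huK ε) (H ε hε) ξ).trans ?_
  have h3 : 0 ≤ C * (ε : ℝ) ^ s := mul_nonneg hC.le (zpow_nonneg ε.2.1.le s)
  nlinarith

/-- The origin lies in no cone and needs a piece of its own. Only `p = 0` matters there, and
moderateness suffices. -/
theorem decayOn_zero (hM : IsWeightSequence M) {Ω : TopologicalSpace.Opens (Space n)} {u : Net n}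
    (hmod : IsModerate Ω u) {K : Set (Space n)} (hK : IsCompact K) (hKΩ : K ⊆ Ω)
    (hu : ∀ ε, ContDiff ℝ ∞ (u ε)) (huK : ∀ ε, tsupport (u ε) ⊆ K) :
    DecayOn M (fun ε => 𝓕 (u ε)) {0} := by
  obtain ⟨m, hm⟩ := hmod.bd hK hKΩ 0
  obtain ⟨C, hC, η, H⟩ := exists_fourier_le_of_bd hK hu huK (hm 0 le_rfl)
  refine ⟨0, m, C, hC, 1, one_pos, η, fun ε hε ξ hξ p => ?_⟩
  rw [Set.mem_singleton_iff] at hξ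
  subst hξ
  have h1 := one_le_inv_eps ε
  have h2 := (hM.pos p).le
  rcases p with _ | p
  · simpa [hM.zero, inv_eps_pow_eq_zpow] using H ε hε 0
  · rw [norm_zero, zero_pow (Nat.succ_ne_zero p), zero_mul]
    positivity

/-- Multiplication by a cut-off function of class `M` preserves the affine decay, up to shrinking
the set of frequencies. -/
theorem DecayOn.cutoff_mul (hM : IsWeightSequence M) {Ω : TopologicalSpace.Opens (Space n)}
    {u : Net n} (hmod : IsModerate Ω u) {K : Set (Space n)} (hK : IsCompact K) (hKΩ : K ⊆ Ω)
    (hu : ∀ ε, ContDiff ℝ ∞ (u ε)) (huK : ∀ ε, tsupport (u ε) ⊆ K)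
    {φ : Space n → ℂ} (hφ : ContDiff ℝ ∞ φ) (hφc : HasCompactSupport φ) {c : ℝ} (hc : 0 < c)
    (hφM : ∀ k x, ‖iteratedFDeriv ℝ k φ x‖ ≤ c ^ (k + 1) * M k)
    {Γ S : Set (Space n)} {δ : ℝ} (hδ : 0 < δ) (hδ1 : δ < 1)
    (hS : ∀ ξ ∈ S, ∀ η, ‖ξ - η‖ ≤ δ * ‖ξ‖ → η ∈ Γ)
    (h : DecayOn M (fun ε => 𝓕 (u ε)) Γ) : DecayOn M (fun ε => 𝓕 (φ * u ε)) S := by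
  obtain ⟨a, b, C, hC, L, hL, ε₀, H⟩ := h
  obtain ⟨m, hm⟩ := hmod.bd hK hKΩ (n + 1)
  obtain ⟨D, hD, η, HD⟩ := exists_fourier_le_of_bd hK hu huK (hm 0 (Nat.zero_le _))
  obtain ⟨D', hD', η', HD'⟩ := exists_fourier_le_of_bd hK hu huK (hm (n + 1) le_rfl)
  have huc : ∀ ε, HasCompactSupport (u ε) := fun ε =>
    hK.of_isClosed_subset (isClosed_tsupport _) (huK ε)
  have hφi : Integrable φ := hφ.continuous.integrable_of_hasCompactSupport hφc
  have hφI : Integrable (𝓕 φ) := integrable_fourier_of_hasCompactSupport hφ hφc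
  have huI : ∀ ε, Integrable (𝓕 (u ε)) := fun ε =>
    integrable_fourier_of_hasCompactSupport (hu ε) (huc ε)
  set I := ∫ η, ‖𝓕 φ η‖ with hI
  have hI0 : 0 ≤ I := integral_nonneg fun _ => norm_nonneg _
  set V := volume.real (tsupport φ) with hV
  have hV0 : 0 ≤ V := measureReal_nonneg
  have hJ := decayConst_nonneg n
  set Q := decayConst n * (D + D') with hQ
  have hQ0 : 0 ≤ Q := by positivity
  have hφd : ∀ p ζ, ‖ζ‖ ^ p * ‖𝓕 φ ζ‖ ≤ c * V * c ^ p * M p := fun p ζ =>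
    (norm_pow_mul_fourier_le hφ hφc subset_rfl (fun x _ => hφM p x) ζ).trans_eq (by ring)
  have hδ' : 0 < 1 - δ := by linarith
  -- Near frequencies contribute `I * C` and `L / (1 - δ)`, far ones `c * V * Q` and `c / δ`; the
  -- shift `m` is the moderate growth of the `L¹` norm of `𝓕 (u ε)`.
  refine ⟨a, b + m, I * C + c * V * Q + 1, by positivity, L / (1 - δ) + c / δ, by positivity,
    min ε₀ (min η η'), fun ε hε ξ hξ p => ?_⟩
  have hε1 : ε ≤ ε₀ := hε.trans (min_le_left _ _)
  have hε2 : ε ≤ η := hε.trans ((min_le_right _ _).trans (min_le_left _ _))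
  have hε3 : ε ≤ η' := hε.trans ((min_le_right _ _).trans (min_le_right _ _))
  have he := one_le_inv_eps ε
  have hMp := (hM.pos p).le
  set e := (ε : ℝ)⁻¹ with he'
  have huint : ∫ ζ, ‖𝓕 (u ε) ζ‖ ≤ Q * e ^ m := by
    have := integral_pow_mul_le_of_decay (k := 0) (huI ε).1 (HD ε hε2)
      (d' := D' * (ε : ℝ) ^ (-(m : ℤ))) (by simpa only [Nat.zero_add] using HD' ε hε3)
    simp only [pow_zero, one_mul] at this
    refine this.trans_eq ?_
    rw [inv_eps_pow_eq_zpow, hQ]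
    ring
  -- If `‖ξ - ζ‖ ≤ δ * ‖ξ‖`, then `ζ ∈ Γ` and `‖ζ‖ ≥ (1 - δ) * ‖ξ‖`, so `𝓕 (u ε)` supplies the
  -- decay. Otherwise `‖ξ‖ ≤ ‖ξ - ζ‖ / δ` and `𝓕 φ` supplies it.
  have hpt : ∀ ζ, ‖ξ‖ ^ p * (‖𝓕 φ (ξ - ζ)‖ * ‖𝓕 (u ε) ζ‖) ≤
      ‖𝓕 φ (ξ - ζ)‖ * (C * (L / (1 - δ)) ^ p * M p * e ^ (a * p + b)) +
        c * V * (c / δ) ^ p * M p * ‖𝓕 (u ε) ζ‖ := by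
    intro ζ
    rcases le_or_gt ‖ξ - ζ‖ (δ * ‖ξ‖) with hle | hlt
    · have h1 : (1 - δ) * ‖ξ‖ ≤ ‖ζ‖ := by
        have := norm_sub_norm_le ξ ζ
        linarith
      have h2 : ‖ξ‖ ≤ (1 - δ)⁻¹ * ‖ζ‖ := by
        rw [inv_mul_eq_div, le_div_iff₀ hδ']
        linarith
      have h3 := H ε hε1 ζ (hS ξ hξ ζ hle) p
      have h4 : ‖ξ‖ ^ p * ‖𝓕 (u ε) ζ‖ ≤ C * (L / (1 - δ)) ^ p * M p * e ^ (a * p + b) :=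
        calc ‖ξ‖ ^ p * ‖𝓕 (u ε) ζ‖ ≤ ((1 - δ)⁻¹ * ‖ζ‖) ^ p * ‖𝓕 (u ε) ζ‖ := by gcongr
          _ = (1 - δ)⁻¹ ^ p * (‖ζ‖ ^ p * ‖𝓕 (u ε) ζ‖) := by rw [mul_pow]; ring
          _ ≤ (1 - δ)⁻¹ ^ p * (C * L ^ p * M p * e ^ (a * p + b)) := by gcongr
          _ = _ := by rw [div_eq_mul_inv, mul_pow]; ring
      have h5 : 0 ≤ c * V * (c / δ) ^ p * M p * ‖𝓕 (u ε) ζ‖ := by positivity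
      calc ‖ξ‖ ^ p * (‖𝓕 φ (ξ - ζ)‖ * ‖𝓕 (u ε) ζ‖)
          = ‖𝓕 φ (ξ - ζ)‖ * (‖ξ‖ ^ p * ‖𝓕 (u ε) ζ‖) := by ring
        _ ≤ ‖𝓕 φ (ξ - ζ)‖ * (C * (L / (1 - δ)) ^ p * M p * e ^ (a * p + b)) := by gcongr
        _ ≤ _ := by linarith
    · have h2 : ‖ξ‖ ≤ δ⁻¹ * ‖ξ - ζ‖ := by
        rw [inv_mul_eq_div, le_div_iff₀ hδ]
        linarith
      have h4 : ‖ξ‖ ^ p * ‖𝓕 φ (ξ - ζ)‖ ≤ c * V * (c / δ) ^ p * M p :=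
        calc ‖ξ‖ ^ p * ‖𝓕 φ (ξ - ζ)‖ ≤ (δ⁻¹ * ‖ξ - ζ‖) ^ p * ‖𝓕 φ (ξ - ζ)‖ := by gcongr
          _ = δ⁻¹ ^ p * (‖ξ - ζ‖ ^ p * ‖𝓕 φ (ξ - ζ)‖) := by rw [mul_pow]; ring
          _ ≤ δ⁻¹ ^ p * (c * V * c ^ p * M p) :=
            mul_le_mul_of_nonneg_left (hφd p _) (by positivity)
          _ = _ := by rw [div_eq_mul_inv, mul_pow]; ring
      have h5 : 0 ≤ ‖𝓕 φ (ξ - ζ)‖ * (C * (L / (1 - δ)) ^ p * M p * e ^ (a * p + b)) := by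
        positivity
      calc ‖ξ‖ ^ p * (‖𝓕 φ (ξ - ζ)‖ * ‖𝓕 (u ε) ζ‖)
          = (‖ξ‖ ^ p * ‖𝓕 φ (ξ - ζ)‖) * ‖𝓕 (u ε) ζ‖ := by ring
        _ ≤ (c * V * (c / δ) ^ p * M p) * ‖𝓕 (u ε) ζ‖ := by gcongr
        _ ≤ _ := by linarith
  have hφI' : Integrable fun ζ => ‖𝓕 φ (ξ - ζ)‖ := (hφI.comp_sub_left ξ).norm
  have hφI'' : ∫ ζ, ‖𝓕 φ (ξ - ζ)‖ = I :=
    integral_sub_left_eq_self (fun ζ => ‖𝓕 φ ζ‖) volume ξ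
  have hmain : ‖ξ‖ ^ p * ‖𝓕 (φ * u ε) ξ‖ ≤
      I * (C * (L / (1 - δ)) ^ p * M p * e ^ (a * p + b)) +
        c * V * (c / δ) ^ p * M p * (Q * e ^ m) := by
    rw [fourier_mul_eq_integral hφi (hu ε) (huc ε)]
    have h1 : ‖ξ‖ ^ p * ‖∫ ζ, 𝓕 φ (ξ - ζ) * 𝓕 (u ε) ζ‖
        = ‖∫ ζ, (‖ξ‖ ^ p : ℝ) • (𝓕 φ (ξ - ζ) * 𝓕 (u ε) ζ)‖ := by
      rw [integral_smul, norm_smul, Real.norm_of_nonneg (by positivity)]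
    rw [h1]
    refine (norm_integral_le_of_norm_le
      ((hφI'.mul_const (C * (L / (1 - δ)) ^ p * M p * e ^ (a * p + b))).add
        ((huI ε).norm.const_mul (c * V * (c / δ) ^ p * M p))) (Eventually.of_forall fun ζ => ?_)).trans ?_
    · rw [norm_smul, norm_mul, Real.norm_of_nonneg (by positivity)]
      exact hpt ζ
    · simp only [Pi.add_apply]
      rw [integral_add (hφI'.mul_const _) ((huI ε).norm.const_mul _), integral_mul_const,
        integral_const_mul, hφI'']
      gcongr
  refine hmain.trans ?_
  set Λ := L / (1 - δ) + c / δ with hΛ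
  have hΛ1 : L / (1 - δ) ≤ Λ := le_add_of_nonneg_right (by positivity)
  have hΛ2 : c / δ ≤ Λ := le_add_of_nonneg_left (by positivity)
  have hΛ0 : 0 ≤ Λ := by positivity
  have he0 : 0 ≤ e := by linarith
  have e1 : e ^ (a * p + b) ≤ e ^ (a * p + (b + m)) := pow_le_pow_right₀ he (by omega)
  have e2 : e ^ m ≤ e ^ (a * p + (b + m)) := pow_le_pow_right₀ he (by omega)
  calc _ ≤ I * (C * Λ ^ p * M p * e ^ (a * p + (b + m))) +
        c * V * Λ ^ p * M p * (Q * e ^ (a * p + (b + m))) := by gcongr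
    _ = (I * C + c * V * Q) * Λ ^ p * M p * e ^ (a * p + (b + m)) := by ring
    _ ≤ _ := by gcongr ?_ * Λ ^ p * M p * _; linarith

end Decay

/-! ### Nets with compact supports -/

section Nets

variable {n : ℕ} {M : ℕ → ℝ} {Ω Ω' : TopologicalSpace.Opens (Space n)}

theorem contDiff_of_tsupport_subset {f : Space n → ℂ} (hf : ContDiffOn ℝ ∞ f Ω)
    (hs : tsupport f ⊆ Ω) : ContDiff ℝ ∞ f := by
  refine contDiff_iff_contDiffAt.2 fun x => ?_
  by_cases hx : x ∈ tsupport f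
  · exact hf.contDiffAt (Ω.isOpen.mem_nhds (hs hx))
  · exact (contDiffAt_const (c := (0 : ℂ))).congr_of_eventuallyEq
      (notMem_tsupport_iff_eventuallyEq.1 hx)

theorem pderiv_eq_zero_of_notMem_tsupport {k : ℕ} (w : Fin k → Fin n) {f : Space n → ℂ}
    {x : Space n} (hx : x ∉ tsupport f) : pderiv w f x = 0 := by
  have : iteratedFDeriv ℝ k f x = 0 :=
    image_eq_zero_of_notMem_tsupport fun h => hx (tsupport_iteratedFDeriv_subset k h)
  rw [pderiv, this]
  rfl

/-- All derivatives vanish off `K`, so bounds on `K` are global; no inclusion between `Ω` and `Ω'`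
is needed. -/
theorem IsModerate.of_tsupport_subset {u : Net n} (h : IsModerate Ω' u) {K : Set (Space n)}
    (hK : IsCompact K) (hKΩ : K ⊆ Ω') (huK : ∀ ε, tsupport (u ε) ⊆ K) : IsModerate Ω u := by
  refine ⟨fun ε => (contDiff_of_tsupport_subset (h.1 ε) ((huK ε).trans hKΩ)).contDiffOn,
    fun _ _ _ k w => ?_⟩
  obtain ⟨m, C, hC, η, H⟩ := h.2 K hK hKΩ k w
  refine ⟨m, C, hC, η, fun ε hε x _ => ?_⟩
  by_cases hx : x ∈ K
  · exact H ε hε x hx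
  · rw [pderiv_eq_zero_of_notMem_tsupport w fun h => hx (huK ε h), norm_zero]
    exact mul_nonneg hC.le (zpow_nonneg ε.2.1.le _)

theorem IsNegligible.of_tsupport_subset {u : Net n} (h : IsNegligible Ω' u) {K : Set (Space n)}
    (hK : IsCompact K) (hKΩ : K ⊆ Ω') (huK : ∀ ε, tsupport (u ε) ⊆ K) : IsNegligible Ω u := by
  intro _ _ _ k w m
  obtain ⟨C, hC, η, H⟩ := h K hK hKΩ k w m
  refine ⟨C, hC, η, fun ε hε x _ => ?_⟩
  by_cases hx : x ∈ K
  · exact H ε hε x hx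
  · rw [pderiv_eq_zero_of_notMem_tsupport w fun h => hx (huK ε h), norm_zero]
    exact mul_nonneg hC.le (zpow_nonneg ε.2.1.le _)

theorem cl_eq_cl_iff {u v : moderate Ω} :
    cl u = cl v ↔ IsNegligible Ω ((u : Net n) - (v : Net n)) :=
  Ideal.Quotient.eq

theorem restrict_cl (h : Ω' ≤ Ω) {u : Net n} (hu : IsModerate Ω u) :
    restrict h (cl ⟨u, hu⟩) = cl ⟨u, hu.mono h⟩ := rfl

theorem ofSmooth_mul_cl {φ : Space n → ℂ} (hφ : ContDiffOn ℝ ∞ φ Ω) {u : Net n}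
    (hu : IsModerate Ω u) :
    ofSmooth φ hφ * cl ⟨u, hu⟩ = cl ⟨fun ε => φ * u ε, (isModerate_const hφ).mul hu⟩ := rfl

theorem exists_eq_cl (f : Colombeau Ω) : ∃ u : Net n, ∃ hu : IsModerate Ω u, f = cl ⟨u, hu⟩ := by
  obtain ⟨u, rfl⟩ := Ideal.Quotient.mk_surjective f
  exact ⟨u.1, u.2, rfl⟩

theorem IsNegligible.mul_left {φ : Space n → ℂ} (hφ : ContDiffOn ℝ ∞ φ Ω) {u : Net n}
    (hu : IsModerate Ω u) (h : IsNegligible Ω u) : IsNegligible Ω (fun ε => φ * u ε) :=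
  (negligible Ω).mul_mem_left ⟨fun _ => φ, isModerate_const hφ⟩
    (b := (⟨u, hu⟩ : moderate Ω)) h

theorem IsModerate.sub {u v : Net n} (hu : IsModerate Ω u) (hv : IsModerate Ω v) :
    IsModerate Ω (u - v) :=
  (moderate Ω).sub_mem hu hv

/-- Functions of class `M` with uniform bounds and compact support are test functions. -/
theorem mem_testFunctions {φ : Space n → ℂ} (hφ : ContDiff ℝ ∞ φ) (hφc : HasCompactSupport φ)
    (hs : tsupport φ ⊆ Ω) {c : ℝ} (hc : 0 < c)
    (hφM : ∀ k x, ‖iteratedFDeriv ℝ k φ x‖ ≤ c ^ (k + 1) * M k) : φ ∈ testFunctions M Ω :=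
  ⟨⟨hφ.contDiffOn, fun _ _ _ => ⟨c, hc, fun k w x _ => (norm_pderiv_le w φ x).trans (hφM k x)⟩⟩,
    hφc, hs⟩

/-- The product of an ultraregular net with a cut-off function has affine decay. -/
theorem IsUltraregularNet.decayOn_cutoff_mul (hM : IsWeightSequence M) {u : Net n}
    (hu : IsUltraregularNet M affineSequences Ω u) {φ : Space n → ℂ} (hφ : ContDiff ℝ ∞ φ)
    (hφc : HasCompactSupport φ) (hs : tsupport φ ⊆ Ω) {c : ℝ} (hc : 0 < c)
    (hφM : ∀ k x, ‖iteratedFDeriv ℝ k φ x‖ ≤ c ^ (k + 1) * M k) :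
    DecayOn M (fun ε => 𝓕 (φ * u ε)) Set.univ := by
  obtain ⟨N, ⟨a, b, hN⟩, C, hC, ε₀, H⟩ := hu.2 _ hφc hs
  have hsupp : ∀ ε, tsupport (φ * u ε) ⊆ tsupport φ := fun ε => tsupport_mul_subset_left
  refine decayOn_fourier_of_bounds hM hφc
    (fun ε => contDiff_of_tsupport_subset (hφ.contDiffOn.mul (hu.1 ε)) ((hsupp ε).trans hs))
    -- The factor `n ^ k` counts the words of length `k` when partial derivatives bound the operator
    -- norm; the binomial theorem then sums the Leibniz terms to `(c + n * C) ^ p`.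
    hsupp (a := ⌈a⌉₊) (b := ⌈b⌉₊) (C := c * C) (L := c + n * C) (ε₀ := ε₀) (by positivity)
    (by positivity) fun ε hε x hx p => ?_
  have he := one_le_inv_eps ε
  have hε0 := ε.2.1
  have hu' : ∀ k ≤ p, ‖iteratedFDeriv ℝ k (u ε) x‖ ≤
      C * (n * C) ^ k * M k * ((ε : ℝ)⁻¹) ^ (⌈a⌉₊ * p + ⌈b⌉₊) := by
    intro k hk
    have hNk : (N k : ℝ) ≤ (⌈a⌉₊ * p + ⌈b⌉₊ : ℕ) := by
      have h1 : (N k : ℝ) ≤ a * k + b := by exact_mod_cast hN k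
      have h2 : (a : ℝ) ≤ ⌈a⌉₊ := by exact_mod_cast Nat.le_ceil a
      have h3 : (b : ℝ) ≤ ⌈b⌉₊ := by exact_mod_cast Nat.le_ceil b
      have h4 : (k : ℝ) ≤ p := by exact_mod_cast hk
      push_cast
      refine h1.trans (add_le_add ?_ h3)
      exact mul_le_mul h2 h4 (by positivity) (by positivity)
    have hMk := (hM.pos k).le
    have h1 : ∀ w : Fin k → Fin n, ‖pderiv w (u ε) x‖ ≤
        C ^ (k + 1) * M k * ((ε : ℝ)⁻¹) ^ (⌈a⌉₊ * p + ⌈b⌉₊) := by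
      intro w
      refine (H k w ε hε x hx).trans (mul_le_mul_of_nonneg_left ?_ (by positivity))
      rw [inv_eps_pow_eq_rpow]
      exact Real.rpow_le_rpow_of_exponent_ge hε0 ε.2.2 (neg_le_neg hNk)
    refine (norm_iteratedFDeriv_le_of_pderiv (u ε) x (by positivity) h1).trans_eq ?_
    rw [Fintype.card_fun, Fintype.card_fin, Fintype.card_fin]
    push_cast
    rw [mul_pow]
    ring
  have hx' : x ∈ (Ω : Set (Space n)) := hs hx
  have hW := norm_iteratedFDerivWithin_mul_le (𝕜 := ℝ) hφ.contDiffOn (hu.1 ε)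
    Ω.isOpen.uniqueDiffOn hx' (n := p) (by exact_mod_cast le_top)
  simp only [iteratedFDerivWithin_of_isOpen _ Ω.isOpen hx'] at hW
  refine hW.trans ?_
  set e := ((ε : ℝ)⁻¹) ^ (⌈a⌉₊ * p + ⌈b⌉₊) with he'
  have he0 : 0 ≤ e := by positivity
  calc _ ≤ ∑ i ∈ Finset.range (p + 1),
        (c * C * M p * e) * (c ^ i * (n * C) ^ (p - i) * (p.choose i : ℝ)) := by
        refine Finset.sum_le_sum fun i hi => ?_
        have hi : i ≤ p := Nat.lt_succ_iff.1 (Finset.mem_range.1 hi)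
        have hMi := (hM.pos i).le
        have hMj := (hM.pos (p - i)).le
        have hMM : M i * M (p - i) ≤ M p := by
          simpa [Nat.add_sub_cancel' hi] using hM.mul_le i (p - i)
        calc _ ≤ (p.choose i : ℝ) * (c ^ (i + 1) * M i) *
              (C * (n * C) ^ (p - i) * M (p - i) * e) := by
              gcongr
              · exact hφM i x
              · exact hu' (p - i) (Nat.sub_le _ _)
          _ = (c * C * (M i * M (p - i)) * e) *
              (c ^ i * (n * C) ^ (p - i) * (p.choose i : ℝ)) := by ring
          _ ≤ _ := by gcongr
    _ = c * C * (c + n * C) ^ p * M p * e := by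
        rw [← Finset.mul_sum, ← add_pow]
        ring

/-- A single cut-off `φ` supported in the good open set serves all directions. The nets `φ g` and `φ
u` differ by `φ (g - u)`, negligible on all of `Ω` because of its support. -/
theorem singularConeAt_eq_empty_of_notMem_singsupp (hM : IsWeightSequence M) {f : Colombeau Ω}
    {x₀ : Space n} (hx₀ : x₀ ∈ Ω) (h : x₀ ∉ singsupp M affineSequences f) :
    singularConeAt M f x₀ = ∅ := by
  have hmem : x₀ ∈ sSup {Ω' : TopologicalSpace.Opens (Space n) |
      ∃ h : Ω' ≤ Ω, restrict h f ∈ ultraregular M affineSequences Ω'} := by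
    by_contra h'
    exact h ⟨hx₀, h'⟩
  obtain ⟨Ω', ⟨hle, ⟨u, hmod⟩, hu, hur⟩, hx₀'⟩ := TopologicalSpace.Opens.mem_sSup.1 hmem
  replace hmod : IsModerate Ω' u := hmod
  obtain ⟨g, hg, rfl⟩ := exists_eq_cl f
  obtain ⟨φ, hφ, hφc, hs, hone, c, hc, hφM⟩ := hM.exists_cutoff (Ω'.isOpen.mem_nhds hx₀')
  have hsΩ : tsupport φ ⊆ Ω := hs.trans hle
  refine Set.eq_empty_iff_forall_notMem.2 fun ξ₀ hξ₀ => ?_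
  have hφt : φ ∈ testFunctions M Ω := mem_testFunctions hφ hφc hsΩ hc hφM
  simp only [singularConeAt, Set.mem_iInter] at hξ₀
  obtain ⟨hne, hno⟩ := hξ₀ φ hφt hone
  have hsupp : ∀ v : Net n, ∀ ε, tsupport (φ * v ε) ⊆ tsupport φ := fun v ε =>
    tsupport_mul_subset_left
  rw [restrict_cl] at hu
  have hdiff : IsNegligible Ω' (g - u) := cl_eq_cl_iff.1 hu.symm
  have hw : IsModerate Ω (fun ε => φ * u ε) :=
    ((isModerate_const hφ.contDiffOn).mul hmod).of_tsupport_subset hφc hs (hsupp _)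
  refine hno ⟨{0}ᶜ, ⟨isOpen_compl_singleton, hne, by simp, fun η hη t ht => ?_⟩,
    ⟨_, hw⟩, ⟨?_, tsupport φ, hφc, hsΩ, hsupp _⟩,
    (hur.decayOn_cutoff_mul hM hφ hφc hs hc hφM).exists_associatedFunction_le hM⟩
  · simpa [ht.ne'] using hη
  · have hneg : IsNegligible Ω (fun ε => φ * (g - u) ε) :=
      (hdiff.mul_left hφ.contDiffOn ((hg.mono hle).sub hmod)).of_tsupport_subset
        hφc hs (hsupp _)
    rw [ofSmooth_mul_cl]
    refine Eq.symm (cl_eq_cl_iff.2 ?_)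
    convert hneg using 1
    ext ε x
    simp [mul_sub]

end Nets

/-! ### Reconstruction of an ultraregular representative -/

section Reconstruction

variable {n : ℕ} {M : ℕ → ℝ} {Ω Ω' : TopologicalSpace.Opens (Space n)}

/-- Induction on a finite index set, the latest set containing the point having priority.
Measurability is needed to integrate the glued transform. -/
theorem exists_measurable_selection {α ι : Type*} [MeasurableSpace α] [MeasurableSpace ι]
    [Finite ι] [Nonempty ι] {S : ι → Set α} (hS : ∀ i, MeasurableSet (S i))
    (hcov : ∀ x, ∃ i, x ∈ S i) : ∃ σ : α → ι, Measurable σ ∧ ∀ x, x ∈ S (σ x) := by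
  classical
  have := Fintype.ofFinite ι
  have key : ∀ T : Finset ι, ∃ σ : α → ι, Measurable σ ∧ ∀ x, ∀ i ∈ T, x ∈ S i → x ∈ S (σ x) := by
    intro T
    induction T using Finset.induction_on with
    | empty => exact ⟨fun _ => Classical.arbitrary ι, measurable_const, by simp⟩
    | insert j T _ ih =>
      obtain ⟨σ, hσ, h⟩ := ih
      refine ⟨fun x => if x ∈ S j then j else σ x, Measurable.ite (hS j) measurable_const hσ,
        fun x i hi hx => ?_⟩
      by_cases hj : x ∈ S j
      · simp [hj]
      · rcases Finset.mem_insert.1 hi with rfl | hi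
        · exact absurd hx hj
        · simpa [hj] using h x i hi hx
  obtain ⟨σ, hσ, h⟩ := key Finset.univ
  refine ⟨σ, hσ, fun x => ?_⟩
  obtain ⟨i, hi⟩ := hcov x
  exact h x i (Finset.mem_univ i) hi

theorem measurable_select {α β ι : Type*} [MeasurableSpace α] [MeasurableSpace β]
    [MeasurableSpace ι] [MeasurableSingletonClass ι] [Countable ι] {H : ι → α → β}
    (hH : ∀ i, Measurable (H i)) {σ : α → ι} (hσ : Measurable σ) :
    Measurable fun x => H (σ x) x := by
  have hF : Measurable fun q : ι × α => H q.1 q.2 := measurable_from_prod_countable_right hH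
  exact hF.comp (hσ.prodMk measurable_id)

/-- The inverse Fourier transform of a net with affine decay satisfies ultraregular bounds. -/
theorem DecayOn.exists_iteratedFDeriv_fourierInv_le (hM : IsWeightSequence M)
    {G : Eps → Space n → ℂ} (hG : ∀ ε, AEStronglyMeasurable (G ε)) (hr : ∀ ε, RapidDecay (G ε))
    (h : DecayOn M G Set.univ) :
    ∃ a b : ℕ, ∃ C : ℝ, 0 < C ∧ ∃ ε₀ : Eps, ∀ ε : Eps, ε ≤ ε₀ → ∀ k x,
      ‖iteratedFDeriv ℝ k (𝓕⁻ (G ε)) x‖ ≤ C ^ (k + 1) * M k * ((ε : ℝ)⁻¹) ^ (a * k + b) := by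
  obtain ⟨a, b, C, hC, L, hL, ε₀, H⟩ := h
  obtain ⟨A, hA, B, hB, hst⟩ := hM.stable
  have hJ := decayConst_nonneg n
  have hpi := Real.pi_pos
  have hMq := (hM.pos (n + 1)).le
  set D := decayConst n * (C + C * A * M (n + 1) * (L * B) ^ (n + 1)) with hD
  set Λ := 2 * Real.pi * (L + L * B) with hΛ
  have hD0 : 0 ≤ D := by positivity
  have hΛ0 : 0 ≤ Λ := by positivity
  -- Integrability uses order `k + n + 1`, whose exponent `a * (k + n + 1) + b` is still affine in
  -- `k`.
  refine ⟨a, a * (n + 1) + b, D + Λ + 1, by positivity, ε₀, fun ε hε k x => ?_⟩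
  have he := one_le_inv_eps ε
  have hMk := (hM.pos k).le
  set e := ((ε : ℝ)⁻¹) ^ (a * k + (a * (n + 1) + b)) with he'
  have he0 : 0 ≤ e := by positivity
  have h1 : ∀ ξ, ‖ξ‖ ^ k * ‖G ε ξ‖ ≤ C * (L + L * B) ^ k * M k * e := fun ξ => by
    refine (H ε hε ξ trivial k).trans ?_
    gcongr ?_ * ?_ ^ k * _ * ?_
    · exact le_add_of_nonneg_right (by positivity)
    · exact pow_le_pow_right₀ he (by omega)
  have h2 : ∀ ξ, ‖ξ‖ ^ (k + n + 1) * ‖G ε ξ‖ ≤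
      C * A * M (n + 1) * (L * B) ^ (n + 1) * (L + L * B) ^ k * M k * e := fun ξ => by
    -- (H2) returns from `M (k + n + 1)` to `M k` at a geometric cost.
    have hMs : M (k + n + 1) ≤ A * B ^ (k + n + 1) * M k * M (n + 1) := by
      have := hst (k + n + 1) k (by omega)
      rwa [show k + n + 1 - k = n + 1 by omega] at this
    refine (H ε hε ξ trivial (k + n + 1)).trans ?_
    have hpow : ((ε : ℝ)⁻¹) ^ (a * (k + n + 1) + b) = e := by
      rw [he']
      congr 1
      ring
    rw [hpow]
    calc C * L ^ (k + n + 1) * M (k + n + 1) * e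
        ≤ C * L ^ (k + n + 1) * (A * B ^ (k + n + 1) * M k * M (n + 1)) * e := by gcongr
      _ = C * A * M (n + 1) * (L * B) ^ (n + 1) * (L * B) ^ k * M k * e := by ring
      _ ≤ _ := by
        gcongr ?_ * ?_ ^ k * _ * _
        exact le_add_of_nonneg_left hL.le
  refine ((hr ε).norm_iteratedFDeriv_fourierInv_le (hG ε) h1 h2 x).trans ?_
  calc _ = D * Λ ^ k * M k * e := by rw [hD, hΛ, mul_pow (2 * Real.pi)]; ring
    _ ≤ (D + Λ + 1) * (D + Λ + 1) ^ k * M k * e := by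
      gcongr ?_ * ?_ ^ k * _ * _ <;> linarith
    _ = _ := by ring

theorem isUltraregularNet_of_bounds {v : Net n} (hv : ∀ ε, ContDiff ℝ ∞ (v ε)) {a b : ℕ} {C : ℝ}
    (hC : 0 < C) {ε₀ : Eps} (H : ∀ ε : Eps, ε ≤ ε₀ → ∀ k x,
      ‖iteratedFDeriv ℝ k (v ε) x‖ ≤ C ^ (k + 1) * M k * ((ε : ℝ)⁻¹) ^ (a * k + b)) :
    IsUltraregularNet M affineSequences Ω v := by
  refine ⟨fun ε => (hv ε).contDiffOn, fun _ _ _ => ⟨fun k => a * k + b, ⟨a, b, fun _ => le_rfl⟩,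
    C, hC, ε₀, fun k w ε hε x _ => (norm_pderiv_le w _ x).trans ((H ε hε k x).trans_eq ?_)⟩⟩
  rw [inv_eps_pow_eq_rpow]
  push_cast
  rfl

theorem isModerate_of_bounds (hM : IsWeightSequence M) {v : Net n} (hv : ∀ ε, ContDiff ℝ ∞ (v ε))
    {a b : ℕ} {C : ℝ} (hC : 0 < C) {ε₀ : Eps} (H : ∀ ε : Eps, ε ≤ ε₀ → ∀ k x,
      ‖iteratedFDeriv ℝ k (v ε) x‖ ≤ C ^ (k + 1) * M k * ((ε : ℝ)⁻¹) ^ (a * k + b)) :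
    IsModerate Ω v := by
  refine ⟨fun ε => (hv ε).contDiffOn, fun _ _ _ k w => ⟨a * k + b, C ^ (k + 1) * M k,
    mul_pos (by positivity) (hM.pos k), ε₀, fun ε hε x _ => (norm_pderiv_le w _ x).trans ?_⟩⟩
  rw [← inv_eps_pow_eq_zpow]
  exact H ε hε k x

/-- Representatives with affine decay on the members of a finite measurable cover of the frequency
space can be glued to an ultraregular representative. -/
theorem exists_ultraregular_of_decayOn (hM : IsWeightSequence M) {K : Set (Space n)}
    (hK : IsCompact K) (hKΩ : K ⊆ Ω) {h : Net n} (hh : ∀ ε, ContDiff ℝ ∞ (h ε))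
    (hhK : ∀ ε, tsupport (h ε) ⊆ K) {ι : Type*} [Finite ι] [Nonempty ι] {w : ι → Net n}
    (hw : ∀ i ε, ContDiff ℝ ∞ (w i ε)) (hwK : ∀ i ε, tsupport (w i ε) ⊆ K)
    (hneg : ∀ i, IsNegligible Ω (h - w i)) {S : ι → Set (Space n)}
    (hS : ∀ i, MeasurableSet (S i)) (hcov : ∀ ξ, ∃ i, ξ ∈ S i)
    (hd : ∀ i, DecayOn M (fun ε => 𝓕 (w i ε)) (S i)) :
    ∃ v : Net n, IsModerate Ω v ∧ IsUltraregularNet M affineSequences Ω v ∧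
      IsNegligible Ω (h - v) := by
  let _ : MeasurableSpace ι := ⊤
  have : MeasurableSingletonClass ι := ⟨fun _ => trivial⟩
  obtain ⟨σ, hσ, hσS⟩ := exists_measurable_selection hS hcov
  have hcs : ∀ f : Space n → ℂ, tsupport f ⊆ K → HasCompactSupport f := fun f hf =>
    hK.of_isClosed_subset (isClosed_tsupport f) hf
  have hint : ∀ f : Space n → ℂ, ContDiff ℝ ∞ f → tsupport f ⊆ K → Integrable f := fun f hf hfK =>
    hf.continuous.integrable_of_hasCompactSupport (hcs f hfK)
  let G : Eps → Space n → ℂ := fun ε ξ => 𝓕 (w (σ ξ) ε) ξ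
  have hGm : ∀ ε, Measurable (G ε) := fun ε =>
    measurable_select (H := fun i => 𝓕 (w i ε))
      (fun i => (continuous_fourier (hint _ (hw i ε) (hwK i ε))).measurable) hσ
  have hGs : ∀ ε, AEStronglyMeasurable (G ε) := fun ε => (hGm ε).aestronglyMeasurable
  have hGr : ∀ ε, RapidDecay (G ε) := by
    intro ε p
    choose d hd using fun i => rapidDecay_fourier (hw i ε) (hcs _ (hwK i ε)) p
    obtain ⟨D, hD⟩ := Finite.exists_le d
    exact ⟨D, fun ξ => (hd (σ ξ) ξ).trans (hD _)⟩
  have hGd : DecayOn M G Set.univ := DecayOn.select hM hd hσS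
  obtain ⟨a, b, C, hC, ε₀, H⟩ := hGd.exists_iteratedFDeriv_fourierInv_le hM hGs hGr
  have hv : ∀ ε, ContDiff ℝ ∞ (𝓕⁻ (G ε)) := fun ε => (hGr ε).contDiff_fourierInv (hGs ε)
  set v : Net n := fun ε => 𝓕⁻ (G ε) with hv'
  have hvm : IsModerate Ω v := isModerate_of_bounds hM hv hC H
  have hvu : IsUltraregularNet M affineSequences Ω v := isUltraregularNet_of_bounds hv hC H
  refine ⟨v, hvm, hvu, ?_⟩
  intro _ _ _ k q m
  let R : Eps → Space n → ℂ := fun ε => 𝓕 (h ε) - G ε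
  have hRs : ∀ ε, AEStronglyMeasurable (R ε) := fun ε =>
    (continuous_fourier (hint _ (hh ε) (hhK ε))).aestronglyMeasurable.sub (hGs ε)
  -- At each frequency the error is the transform of one of finitely many negligible nets, hence
  -- `O(ε ^ m)` uniformly in `ξ`, with any power of `‖ξ‖`.
  have hR : ∀ ε ξ, R ε ξ = 𝓕 ((h - w (σ ξ)) ε) ξ := fun ε ξ => by
    rw [Pi.sub_apply, fourier_sub (hint _ (hh ε) (hhK ε)) (hint _ (hw (σ ξ) ε) (hwK (σ ξ) ε))]
    rfl
  have hsub : ∀ i ε, ContDiff ℝ ∞ ((h - w i) ε) := fun i ε => (hh ε).sub (hw i ε)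
  have hsubK : ∀ i ε, tsupport ((h - w i) ε) ⊆ K := fun i ε =>
    (tsupport_sub _ _).trans (Set.union_subset (hhK ε) (hwK i ε))
  have hRr : ∀ ε, RapidDecay (R ε) := by
    intro ε p
    choose d hd using fun i => rapidDecay_fourier (hsub i ε) (hcs _ (hsubK i ε)) p
    obtain ⟨D, hD⟩ := Finite.exists_le d
    exact ⟨D, fun ξ => by rw [hR]; exact (hd (σ ξ) ξ).trans (hD _)⟩
  have hRd : ∀ p : ℕ, ∃ C : ℝ, 0 < C ∧ ∃ η : Eps, ∀ ε : Eps, ε ≤ η → ∀ ξ,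
      ‖ξ‖ ^ p * ‖R ε ξ‖ ≤ C * (ε : ℝ) ^ (m : ℤ) := by
    intro p
    choose C hC η H using fun i => exists_fourier_le_of_bd hK (hsub i) (hsubK i)
      ((hneg i).bd hK hKΩ p m)
    obtain ⟨C', hC'⟩ := Finite.exists_le C
    have : Nonempty Eps := ⟨⟨1, one_pos, le_rfl⟩⟩
    obtain ⟨η', hη'⟩ := Finite.exists_ge η
    refine ⟨C', (hC (σ 0)).trans_le (hC' _), η', fun ε hε ξ => ?_⟩
    rw [hR]
    exact (H (σ ξ) ε (hε.trans (hη' _)) ξ).trans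
      (mul_le_mul_of_nonneg_right (hC' _) (zpow_nonneg ε.2.1.le _))
  obtain ⟨C₁, hC₁, η₁, H₁⟩ := hRd k
  obtain ⟨C₂, hC₂, η₂, H₂⟩ := hRd (k + n + 1)
  have hJ := decayConst_nonneg n
  have hpi := Real.pi_pos
  refine ⟨(2 * Real.pi) ^ k * (decayConst n * (C₁ + C₂)) + 1, by positivity, min η₁ η₂,
    fun ε hε x _ => ?_⟩
  have heq : (h - v) ε = 𝓕⁻ (R ε) := by
    rw [fourierInv_sub (integrable_fourier_of_hasCompactSupport (hh ε) (hcs _ (hhK ε)))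
      ((hGr ε).integrable (hGs ε)),
      fourierInv_fourier_of_hasCompactSupport (hh ε) (hcs _ (hhK ε))]
    rfl
  rw [heq]
  have hb := (hRr ε).norm_iteratedFDeriv_fourierInv_le (hRs ε)
    (H₁ ε (hε.trans (min_le_left _ _))) (H₂ ε (hε.trans (min_le_right _ _))) x
  refine (norm_pderiv_le q _ x).trans (hb.trans ?_)
  have hz : 0 ≤ (ε : ℝ) ^ (m : ℤ) := zpow_nonneg ε.2.1.le _
  calc _ = (2 * Real.pi) ^ k * (decayConst n * (C₁ + C₂)) * (ε : ℝ) ^ (m : ℤ) := by ring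
    _ ≤ _ := by gcongr; linarith

end Reconstruction

/-! ### Singular directions and singular support -/

section Main

variable {n : ℕ} {M : ℕ → ℝ} {Ω Ω' : TopologicalSpace.Opens (Space n)}

/-- The cone of frequencies whose direction is at distance less than `δ` from `ζ`. -/
def directionCone (ζ : Space n) (δ : ℝ) : Set (Space n) := {ξ | ξ ≠ 0 ∧ ‖‖ξ‖⁻¹ • ξ - ζ‖ < δ}

theorem measurableSet_directionCone (ζ : Space n) (δ : ℝ) :
    MeasurableSet (directionCone ζ δ) := by
  have h : Measurable fun ξ : Space n => ‖‖ξ‖⁻¹ • ξ - ζ‖ :=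
    ((measurable_norm.inv.smul measurable_id).sub measurable_const).norm
  have h' : MeasurableSet {ξ : Space n | ‖‖ξ‖⁻¹ • ξ - ζ‖ < δ} :=
    measurableSet_lt h measurable_const
  exact (measurableSet_singleton (0 : Space n)).compl.inter h'

/-- After scaling by `‖ξ‖⁻¹`, the two deviations add up to less than `2 * δ ≤ r`, which keeps `η` in
a ball inside `Γ`; conicity undoes the scaling. -/
theorem exists_directionCone_subset {Γ : Set (Space n)} {ζ : Space n} (hΓ : IsConicNhd Γ ζ) :
    ∃ δ : ℝ, 0 < δ ∧ δ < 1 ∧ ∀ ξ ∈ directionCone ζ δ, ∀ η, ‖ξ - η‖ ≤ δ * ‖ξ‖ → η ∈ Γ := by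
  obtain ⟨hopen, hmem, -, hcone⟩ := hΓ
  obtain ⟨r, hr, hrΓ⟩ := Metric.isOpen_iff.1 hopen ζ hmem
  refine ⟨min (r / 2) (1 / 2), by positivity, (min_le_right _ _).trans_lt (by norm_num),
    fun ξ hξ η hη => ?_⟩
  set δ := min (r / 2) (1 / 2)
  have hδ : δ ≤ r / 2 := min_le_left _ _
  have hξ0 : 0 < ‖ξ‖ := norm_pos_iff.2 hξ.1
  have h1 : ‖‖ξ‖⁻¹ • η - ‖ξ‖⁻¹ • ξ‖ ≤ δ := by
    rw [← smul_sub, norm_smul, norm_inv, norm_norm, norm_sub_rev, inv_mul_eq_div,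
      div_le_iff₀ hξ0]
    exact hη
  have h2 : ‖ξ‖⁻¹ • η ∈ Γ := by
    refine hrΓ ?_
    rw [Metric.mem_ball, dist_eq_norm]
    have := norm_sub_le_norm_sub_add_norm_sub (‖ξ‖⁻¹ • η) (‖ξ‖⁻¹ • ξ) ζ
    have := hξ.2
    linarith
  have h3 := hcone _ h2 ‖ξ‖ hξ0
  rwa [smul_smul, mul_inv_cancel₀ hξ0.ne', one_smul] at h3

theorem IsNegligible.mono (h : Ω' ≤ Ω) {u : Net n} (hu : IsNegligible Ω u) : IsNegligible Ω' u :=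
  fun K hK hKΩ => hu K hK (hKΩ.trans h)

theorem IsUltraregularNet.mono {R : Set (ℕ → ℝ≥0)} (h : Ω' ≤ Ω) {u : Net n}
    (hu : IsUltraregularNet M R Ω u) : IsUltraregularNet M R Ω' u :=
  ⟨fun ε => (hu.1 ε).mono h, fun K hK hKΩ => hu.2 K hK (hKΩ.trans h)⟩

theorem IsNegligible.congr {u v : Net n} (h : IsNegligible Ω u)
    (huv : ∀ ε, Set.EqOn (u ε) (v ε) Ω) : IsNegligible Ω v := by
  intro K hK hKΩ k w m
  obtain ⟨C, hC, η, H⟩ := h K hK hKΩ k w m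
  refine ⟨C, hC, η, fun ε hε x hx => ?_⟩
  have : pderiv w (v ε) x = pderiv w (u ε) x := by
    have he : v ε =ᶠ[𝓝 x] u ε := by
      filter_upwards [Ω.isOpen.mem_nhds (hKΩ hx)] with y hy using (huv ε hy).symm
    rw [pderiv, pderiv, (Filter.EventuallyEq.iteratedFDeriv ℝ he k).eq_of_nhds]
  rw [this]
  exact H ε hε x hx

/-- The cut-off `ψ`, the representative and the cone all depend on the direction; compactness of the
sphere and one common `φ` reconcile them. -/
theorem notMem_singsupp_of_singularConeAt_eq_empty (hM : IsWeightSequence M) {f : Colombeau Ω}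
    {x₀ : Space n} (hx₀ : x₀ ∈ Ω) (h : singularConeAt M f x₀ = ∅) :
    x₀ ∉ singsupp M affineSequences f := by
  obtain ⟨g, hg, rfl⟩ := exists_eq_cl f
  have hdir : ∀ ζ : Metric.sphere (0 : Space n) 1, ∃ ψ : Space n → ℂ, ContDiffOn ℝ ∞ ψ Ω ∧
      (∀ᶠ x in 𝓝 x₀, ψ x = 1) ∧ ∃ u : Net n, IsModerate Ω u ∧
      IsNegligible Ω ((fun ε => ψ * g ε) - u) ∧ (∀ ε, ContDiff ℝ ∞ (u ε)) ∧
      ∃ K : Set (Space n), IsCompact K ∧ K ⊆ Ω ∧ (∀ ε, tsupport (u ε) ⊆ K) ∧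
      ∃ Γ : Set (Space n), DecayOn M (fun ε => 𝓕 (u ε)) Γ ∧ ∃ δ : ℝ, 0 < δ ∧ δ < 1 ∧
        ∀ ξ ∈ directionCone (ζ : Space n) δ, ∀ η, ‖ξ - η‖ ≤ δ * ‖ξ‖ → η ∈ Γ := by
    intro ζ
    have hζ : (ζ : Space n) ≠ 0 := by
      intro h0
      have := mem_sphere_zero_iff_norm.1 ζ.2
      simp [h0] at this
    have hnot : (ζ : Space n) ∉ singularConeAt M (cl ⟨g, hg⟩) x₀ := by simp [h]
    simp only [singularConeAt, Set.mem_iInter, not_forall] at hnot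
    obtain ⟨ψ, hψ, hψ1, hnot⟩ := hnot
    have hex := not_not.1 fun hc => hnot ⟨hζ, hc⟩
    obtain ⟨Γ, hΓ, ⟨u, hu⟩, ⟨hcl, K, hK, hKΩ, huK⟩, a, -, b, -, C, hC, k, hk, ε₀, H⟩ := hex
    replace hu : IsModerate Ω u := hu
    rw [ofSmooth_mul_cl] at hcl
    exact ⟨ψ, hψ.1.1, hψ1, u, hu, cl_eq_cl_iff.1 hcl.symm,
      fun ε => contDiff_of_tsupport_subset (hu.1 ε) ((huK ε).trans hKΩ), K, hK, hKΩ, huK, Γ,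
      decayOn_of_associatedFunction hM hΓ.2.2.2 hC hk H, exists_directionCone_subset hΓ⟩
  choose ψ hψ hψ1 u hu hneg husm K hK hKΩ huK Γ hdecay δ hδ hδ1 hcone using hdir
  obtain ⟨T, hT⟩ := (isCompact_univ (X := Metric.sphere (0 : Space n) 1)).elim_nhds_subcover
    (fun ζ => Metric.ball ζ (δ ζ)) fun ζ _ => Metric.ball_mem_nhds ζ (hδ ζ)
  -- A `φ` supported here satisfies `φ ψ = φ` for every chosen `ψ`, so each `φ u` represents `φ f`.
  -- Finiteness of `T` makes this set a neighborhood.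
  have hU : {x | x ∈ Ω ∧ ∀ ζ ∈ T, ψ ζ x = 1} ∈ 𝓝 x₀ :=
    (Ω.isOpen.eventually_mem hx₀).and ((Filter.eventually_all_finset T).2 fun ζ _ => hψ1 ζ)
  obtain ⟨φ, hφ, hφc, hφU, hφ1, c, hc, hφM⟩ := hM.exists_cutoff hU
  have hφΩ : tsupport φ ⊆ Ω := fun x hx => (hφU hx).1
  have hφψ : ∀ ζ ∈ T, ∀ x, φ x * ψ ζ x = φ x := by
    intro ζ hζ x
    by_cases hx : x ∈ tsupport φ
    · rw [(hφU hx).2 ζ hζ, mul_one]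
    · rw [image_eq_zero_of_notMem_tsupport hx, zero_mul]
  -- The index `none` handles the zero frequency, where `φ g` itself will do.
  let w : Option T → Net n := fun i => i.elim (fun ε => φ * g ε) fun ζ ε => φ * u ζ ε
  let S : Option T → Set (Space n) := fun i => i.elim {0} fun ζ => directionCone ζ (δ ζ)
  have hmul : ∀ v : Net n, IsModerate Ω v → ∀ ε, ContDiff ℝ ∞ (φ * v ε) := fun v hv ε =>
    contDiff_of_tsupport_subset (hφ.contDiffOn.mul (hv.1 ε))
      (tsupport_mul_subset_left.trans hφΩ)
  have hmod : IsModerate Ω (fun ε => φ * g ε) := (isModerate_const hφ.contDiffOn).mul hg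
  obtain ⟨v, hv, hvu, hvn⟩ := exists_ultraregular_of_decayOn hM (h := fun ε => φ * g ε) hφc hφΩ
    (hmul g hg) (fun ε => tsupport_mul_subset_left) (w := w) (S := S)
    (by
      rintro (_ | ζ) ε
      · exact hmul g hg ε
      · exact hmul _ (hu ζ) ε)
    (by rintro (_ | ζ) ε <;> exact tsupport_mul_subset_left)
    (by
      rintro (_ | ζ)
      · have h0 : (fun ε => φ * g ε) - w none = (0 : Net n) := sub_self _
        rw [h0]
        exact (negligible Ω).zero_mem
      · refine ((hneg ζ).mul_left hφ.contDiffOn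
          (((isModerate_const (hψ ζ)).mul hg).sub (hu ζ))).congr fun ε x _ => ?_
        have := hφψ ζ ζ.2 x
        simp only [w, Pi.mul_apply, Pi.sub_apply, Option.elim_some]
        rw [mul_sub, ← mul_assoc, this])
    (by
      rintro (_ | ζ)
      · exact measurableSet_singleton 0
      · exact measurableSet_directionCone _ _)
    (by
      intro ξ
      rcases eq_or_ne ξ 0 with rfl | hξ
      · exact ⟨none, rfl⟩
      · have hs : ‖ξ‖⁻¹ • ξ ∈ Metric.sphere (0 : Space n) 1 := by
          rw [mem_sphere_zero_iff_norm, norm_smul, norm_inv, norm_norm,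
            inv_mul_cancel₀ (norm_ne_zero_iff.2 hξ)]
        have hmem := hT.2 (Set.mem_univ (⟨_, hs⟩ : Metric.sphere (0 : Space n) 1))
        simp only [Set.mem_iUnion] at hmem
        obtain ⟨ζ, hζT, hζ⟩ := hmem
        refine ⟨some ⟨ζ, hζT⟩, hξ, ?_⟩
        rwa [Metric.mem_ball, Subtype.dist_eq, dist_eq_norm] at hζ)
    (by
      rintro (_ | ζ)
      · exact decayOn_zero hM hmod hφc hφΩ (hmul g hg) fun ε => tsupport_mul_subset_left
      · exact (hdecay ζ).cutoff_mul hM (hu ζ) (hK ζ) (hKΩ ζ) (husm ζ) (huK ζ) hφ hφc hc hφM (hδ ζ)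
          (hδ1 ζ) (hcone ζ))
  -- The net `v` represents `φ f`, hence `f` itself where `φ = 1`.
  obtain ⟨V, hV1, hVo, hxV⟩ := eventually_nhds_iff.1 (hφ1.and (Ω.isOpen.eventually_mem hx₀))
  let W : TopologicalSpace.Opens (Space n) := ⟨V, hVo⟩
  have hWΩ : W ≤ Ω := fun x hx => (hV1 x hx).2
  refine fun hsing => hsing.2 (TopologicalSpace.Opens.mem_sSup.2 ⟨W, ⟨hWΩ, ⟨v, hv.mono hWΩ⟩, ?_,
    hvu.mono hWΩ⟩, hxV⟩)
  rw [restrict_cl]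
  refine Eq.symm (cl_eq_cl_iff.2 ((hvn.mono hWΩ).congr fun ε x hx => ?_))
  simp [(hV1 x hx).1]

end Main

end Ultraregular

theorem mainTheorem10 {n : ℕ} (M : ℕ → ℝ) (hM : Ultraregular.IsWeightSequence M)
    (Ω : TopologicalSpace.Opens (Ultraregular.Space n)) (f : Ultraregular.Colombeau Ω)
    (x₀ : Ultraregular.Space n) (hx₀ : x₀ ∈ Ω) :
    Ultraregular.singularConeAt M f x₀ = ∅ ↔
      x₀ ∉ Ultraregular.singsupp M Ultraregular.affineSequences f :=
  ⟨Ultraregular.notMem_singsupp_of_singularConeAt_eq_empty hM hx₀,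
    Ultraregular.singularConeAt_eq_empty_of_notMem_singsupp hM hx₀⟩
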